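/- Let $V$ be a real vector space of dimension $n+1$ with a volume form $\Omega\in\Lambda^{n+1}V^*$, $\Omega\neq 0$, and the orientation that $\Omega$ defines. Let $F:\Lambda^nV\to\mathbb{R}$ be convex and positively homogeneous ($F(a\xi)=aF(\xi)$ for $a\ge 0$), with $F(\xi)>0$ for $\xi\neq 0$; $F$ need not be symmetric. Let $\iota:\Lambda^nV\to V^*$ be the isomorphism $\iota(\theta)(\eta)=\Omega(\eta\wedge\theta)$, let $\bar F^*:=F\circ\iota^{-1}$ on $V^*$ and $\bar F(v):=\sup\{f(v) : f\in V^*,\ \bar F^*(f)\le 1\}$ on $V$, and let $W_F:=\{v\in V : \bar F(v)\le 1\}$ be the Wulff shape. (The sets $W_F$ are exactly the convex bodies that contain the origin in their interior, and $\bar F^*$ is the support function of $W_F$.) Volumes are taken with respect to $|\Omega|$. Let $B\subset V$ be a bounded open set (not necessarily connected) with $C^2$ boundary, that is, every $p\in\partial B$ has an open neighbourhood $O$ with a $C^2$ function $\rho:O\to\mathbb{R}$ such that $d\rho\neq 0$ on $O$ and $B\cap O=\{\rho<0\}$. Orient $\partial B$ by the rule "outer normal first". Let $\int_{\partial B}dF$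 be the anisotropic area of $\partial B$, that is, the total mass of the measure on $\partial B$ which in every orientation preserving $C^1$ parametrization $\alpha:U\subset\mathbb{R}^n\to\partial B$ is given by $F(\partial_1\alpha\wedge\dots\wedge\partial_n\alpha)\,d\lambda$, where $\lambda$ is the Lebesgue measure on $U$ (for $n=0$, when $\Lambda^0V=\mathbb{R}$, each boundary point has mass $F(1)$ or $F(-1)$ according to its orientation sign). Then $\int_{\partial B}dF$ is finite, the anisotropic outer Minkowski content $$\mathcal{SM}_F(B)=\lim_{t\searrow 0}\frac{\operatorname{vol}(B+tW_F)-\operatorname{vol}(B)}{t}$$ exists, and $$\mathcal{SM}_F(B)=\int_{\partial B}dF.$$ -/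

import Mathlib

open Set Filter Topology MeasureTheory
open scoped Pointwise ENNReal ExteriorAlgebra

namespace AnisoMinkowski

section Linear

variable {V : Type*} [AddCommGroup V] [Module ℝ V] {n : ℕ}

/-- A convex volume density of degree `n` on `V`: a convex, positively homogeneous function on
`Λⁿ V`, vanishing only at `0`. It need not be symmetric. -/
structure IsConvexDensity (F : ⋀[ℝ]^n V → ℝ) : Prop where
  convexOn : ConvexOn ℝ univ F
  homogeneous : ∀ (a : ℝ), 0 ≤ a → ∀ ξ, F (a • ξ) = a * F ξ
  pos : ∀ ξ, ξ ≠ 0 → 0 < F ξ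

/-- The linear map `Λⁿ V → V*`, `θ ↦ (η ↦ Ω(η ∧ θ))`, attached to an `(n+1)`-form `Ω`. -/
noncomputable def hodge (Ω : V [⋀^Fin (n + 1)]→ₗ[ℝ] ℝ) :
    ⋀[ℝ]^n V →ₗ[ℝ] Module.Dual ℝ V :=
  ((exteriorPower.alternatingMapLinearEquiv (R := ℝ) (M := V) (N := ℝ) (n := n)).toLinearMap ∘ₗ
    Ω.curryLeft).flip

theorem hodge_ιMulti (Ω : V [⋀^Fin (n + 1)]→ₗ[ℝ] ℝ) (v : Fin n → V) (η : V) :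
    hodge Ω (exteriorPower.ιMulti ℝ n v) η = Ω (Matrix.vecCons η v) := by
  simp [hodge]

theorem eq_zero_of_forall_vecCons [Fact (Module.finrank ℝ V = n + 1)]
    (Ω : V [⋀^Fin (n + 1)]→ₗ[ℝ] ℝ) (hΩ : Ω ≠ 0) (η : V)
    (h : ∀ v : Fin n → V, Ω (Matrix.vecCons η v) = 0) : η = 0 := by
  have hf : Module.finrank ℝ V = n + 1 := Fact.out
  have : Module.Finite ℝ V := Module.finite_of_finrank_pos (by omega)
  let b : Module.Basis (Fin (n + 1)) ℝ V := Module.finBasisOfFinrankEq ℝ V hf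
  have hb : Ω b ≠ 0 := by
    intro h0
    apply hΩ
    rw [Ω.eq_smul_basis_det b, h0, zero_smul]
  have key : ∀ k, Ω (Function.update b k η) = 0 := by
    intro k
    have h1 := Ω.map_perm (Function.update b k η) (Equiv.swap 0 k)
    have h2 : (fun i => (Function.update (b : Fin (n + 1) → V) k η) (Equiv.swap 0 k i)) =
        Matrix.vecCons η (fun i : Fin n =>
          (Function.update (b : Fin (n + 1) → V) k η) (Equiv.swap 0 k i.succ)) := by
      funext i
      refine Fin.cases ?_ (fun j => ?_) i <;> simp
    have h3 : Ω (fun i => (Function.update (b : Fin (n + 1) → V) k η) (Equiv.swap 0 k i)) = 0 := by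
      rw [h2]; exact h _
    have h4 : Ω (Function.update b k η ∘ Equiv.swap 0 k) = 0 := h3
    rw [h4] at h1
    rcases Int.units_eq_one_or (Equiv.Perm.sign (Equiv.swap 0 k)) with hs | hs <;>
      simpa [hs] using h1.symm
  apply b.ext_elem
  intro k
  have h5 := key k
  rw [← b.sum_repr η] at h5
  rw [Ω.map_update_sum] at h5
  rw [Finset.sum_eq_single k] at h5
  · rw [Ω.map_update_smul, Function.update_eq_self] at h5
    simpa [hb] using h5
  · intro i _ hik
    rw [Ω.map_update_smul, Ω.map_update_self _ (Ne.symm hik), smul_zero]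
  · simp

theorem hodge_bijective [Fact (Module.finrank ℝ V = n + 1)]
    (Ω : V [⋀^Fin (n + 1)]→ₗ[ℝ] ℝ) (hΩ : Ω ≠ 0) : Function.Bijective (hodge Ω) := by
  have hf : Module.finrank ℝ V = n + 1 := Fact.out
  have : Module.Finite ℝ V := Module.finite_of_finrank_pos (by omega)
  have hsurj : Function.Surjective (hodge Ω) := by
    refine LinearMap.flip_injective_iff₂.mp ?_
    refine (injective_iff_map_eq_zero _).mpr fun η hη => ?_
    refine eq_zero_of_forall_vecCons Ω hΩ η fun v => ?_
    rw [← hodge_ιMulti]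
    exact LinearMap.congr_fun hη (exteriorPower.ιMulti ℝ n v)
  refine ⟨?_, hsurj⟩
  refine (LinearMap.injective_iff_surjective_of_finrank_eq_finrank ?_).mpr hsurj
  rw [exteriorPower.finrank_eq, Subspace.dual_finrank_eq, hf]
  simp

/-- The isomorphism `Λⁿ V ≃ V*`, `θ ↦ (η ↦ Ω(η ∧ θ))`, attached to a volume form `Ω` on `V`. -/
noncomputable def hodgeEquiv [Fact (Module.finrank ℝ V = n + 1)]
    (Ω : V [⋀^Fin (n + 1)]→ₗ[ℝ] ℝ) (hΩ : Ω ≠ 0) : ⋀[ℝ]^n V ≃ₗ[ℝ] Module.Dual ℝ V :=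
  LinearEquiv.ofBijective (hodge Ω) (hodge_bijective Ω hΩ)

/-- The functional that `F` and `Ω` induce on `V*`: `F` composed with the inverse of
`Λⁿ V ≃ V*`. -/
noncomputable def dualFunctional [Fact (Module.finrank ℝ V = n + 1)]
    (Ω : V [⋀^Fin (n + 1)]→ₗ[ℝ] ℝ) (hΩ : Ω ≠ 0) (F : ⋀[ℝ]^n V → ℝ) (f : Module.Dual ℝ V) : ℝ :=
  F ((hodgeEquiv Ω hΩ).symm f)

/-- The functional on `V` dual to `dualFunctional`. -/
noncomputable def primalFunctional [Fact (Module.finrank ℝ V = n + 1)]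
    (Ω : V [⋀^Fin (n + 1)]→ₗ[ℝ] ℝ) (hΩ : Ω ≠ 0) (F : ⋀[ℝ]^n V → ℝ) (v : V) : ℝ :=
  ⨆ f : {f : Module.Dual ℝ V // dualFunctional Ω hΩ F f ≤ 1}, (f : Module.Dual ℝ V) v

/-- The Wulff shape `W_F`. -/
noncomputable def wulffShape [Fact (Module.finrank ℝ V = n + 1)]
    (Ω : V [⋀^Fin (n + 1)]→ₗ[ℝ] ℝ) (hΩ : Ω ≠ 0) (F : ⋀[ℝ]^n V → ℝ) : Set V :=
  {v | primalFunctional Ω hΩ F v ≤ 1}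

end Linear

section Boundary

variable {V : Type*} [NormedAddCommGroup V] [NormedSpace ℝ V] {n : ℕ}

/-- `ρ` is a `C²` defining function of `B` on the open set `O`: it has no critical point there
and `B` is given by `ρ < 0` inside `O`. -/
structure IsDefiningFunction (B O : Set V) (ρ : V → ℝ) : Prop where
  isOpen : IsOpen O
  contDiffOn : ContDiffOn ℝ 2 ρ O
  fderiv_ne_zero : ∀ x ∈ O, fderiv ℝ ρ x ≠ 0
  inter_eq : B ∩ O = {x ∈ O | ρ x < 0}

/-- `B` has `C²` boundary: near every boundary point it has a `C²` defining function. -/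
def HasC2Boundary (B : Set V) : Prop :=
  ∀ p ∈ frontier B, ∃ O ρ, p ∈ O ∧ IsDefiningFunction B O ρ

/-- The vector `w` points strictly out of `B` at the boundary point `p`. -/
def PointsOutward (B : Set V) (p w : V) : Prop :=
  ∃ O ρ, p ∈ O ∧ IsDefiningFunction B O ρ ∧ 0 < fderiv ℝ ρ p w

/-- The `i`-th partial derivative of a map `α` defined on (an open subset of) `ℝⁿ`. -/
noncomputable def partialDeriv (α : (Fin n → ℝ) → V) (x : Fin n → ℝ) (i : Fin n) : V :=
  fderiv ℝ α x (Pi.single i 1)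

/-- `α`, restricted to the open set `U ⊆ ℝⁿ`, is a regular `C¹` parametrization of a relatively
open piece of `∂B`, and `ε = ±1` is its orientation sign with respect to the orientation of `∂B`
given by `Ω` and the "outer normal first" rule. Thus `ε = 1` means that `α` is orientation
preserving. -/
structure IsBoundaryChart (Ω : V [⋀^Fin (n + 1)]→ₗ[ℝ] ℝ) (B : Set V)
    (U : Set (Fin n → ℝ)) (α : (Fin n → ℝ) → V) (ε : ℤˣ) : Prop where
  isOpen : IsOpen U
  contDiffOn : ContDiffOn ℝ 1 α U
  immersion : ∀ x ∈ U, Function.Injective (fderiv ℝ α x)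
  injOn : InjOn α U
  mapsTo : MapsTo α U (frontier B)
  openMap : ∀ U' ⊆ U, IsOpen U' → ∃ O, IsOpen O ∧ α '' U' = O ∩ frontier B
  orientation : ∀ x ∈ U, ∀ w, PointsOutward B (α x) w →
    0 < ((ε : ℤ) : ℝ) * Ω (Matrix.vecCons w (partialDeriv α x))

/-- The measure on `V` that the density `F` induces on the piece of `∂B` parametrized by `α`:
the image under `α` of `F(∂₁α ∧ … ∧ ∂ₙα) dλ` on `U` if `α` preserves orientation. If `α` reverses
orientation, the positively oriented `n`-vector is `-∂₁α ∧ … ∧ ∂ₙα`. -/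
noncomputable def chartMeasure [MeasurableSpace V] (F : ⋀[ℝ]^n V → ℝ)
    (U : Set (Fin n → ℝ)) (α : (Fin n → ℝ) → V) (ε : ℤˣ) : Measure V :=
  ((volume.restrict U).withDensity fun x =>
    ENNReal.ofReal (F (((ε : ℤ) : ℝ) • exteriorPower.ιMulti ℝ n (partialDeriv α x)))).map α

/-- The measure `dF` on the oriented boundary `∂B`, as a measure on `V`: the least measure that
dominates the measures of all charts. The measures of two charts agree on the overlap of their
images, so this is the measure on `∂B` that restricts to `chartMeasure` on the image of each
chart. -/
noncomputable def boundaryMeasure [MeasurableSpace V] (Ω : V [⋀^Fin (n + 1)]→ₗ[ℝ] ℝ)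
    (F : ⋀[ℝ]^n V → ℝ) (B : Set V) : Measure V :=
  ⨆ (U : Set (Fin n → ℝ)) (α : (Fin n → ℝ) → V) (ε : ℤˣ) (_ : IsBoundaryChart Ω B U α ε),
    chartMeasure F U α ε

/-- The anisotropic area `∫_{∂B} dF`. -/
noncomputable def anisotropicArea [MeasurableSpace V] (Ω : V [⋀^Fin (n + 1)]→ₗ[ℝ] ℝ)
    (F : ⋀[ℝ]^n V → ℝ) (B : Set V) : ℝ≥0∞ :=
  boundaryMeasure Ω F B (frontier B)

/-- The anisotropic outer Minkowski content of `B` exists and equals `c`. Volumes are taken with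
respect to the translation invariant measure `|Ω|`. -/
def HasOuterMinkowskiContent [FiniteDimensional ℝ V] [MeasurableSpace V]
    [BorelSpace V] [Fact (Module.finrank ℝ V = n + 1)] (Ω : V [⋀^Fin (n + 1)]→ₗ[ℝ] ℝ) (hΩ : Ω ≠ 0)
    (F : ⋀[ℝ]^n V → ℝ) (B : Set V) (c : ℝ) : Prop :=
  Tendsto (fun t : ℝ =>
      (Ω.measure.real (B + t • wulffShape Ω hΩ F) - Ω.measure.real B) / t)
    (𝓝[>] 0) (𝓝 c)

end Boundary

end AnisoMinkowski

/-! Both sides are localized by a partition of unity near `frontier B`. This is legitimate because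
the Wulff shape `W` is bounded, so for small `t > 0` the layer `(B + tW) \ B` lies close to the
boundary.

In suitable linear coordinates `B` is locally a subgraph `s < g y`. After the substitution `s = g y
+ t * r`, the layer over `y` tends, except possibly at one value of `r`, to the interval `0 ≤ r < h
y`, where `h y` is the supremum of `w.2 - g'(y) w.1` over `w ∈ W`. Dominated convergence, on the
fibres and then over the base, gives the localized limit as an integral of `h`
(`IsSubgraphOn.tendsto_integral`).

The number `h y` is the support function of `W` at the conormal `(v, s) ↦ s - g'(y) v`, and by
Hahn-Banach that support function is `dualFunctional` (`IsConvexDensity.exists_mem_wulffShape_eq`).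
On the area side, `Ω(η ∧ ·)` of the tangent `n`-vector of the graph is the same conormal times
`frameVolume` (`map_vecCons_partialDeriv_graphMap`), and `|frameVolume|` is also the Jacobian
between `|Ω|` and Lebesgue measure. The orientation rule makes the scalar factor positive, so
positive homogeneity suffices and `F` need not be symmetric.

The supremum that defines the boundary measure is computed in a box by the area formula: each chart
contributes at most the graph measure, and the graph is itself a chart
(`IsSubgraphOn.boundaryMeasure_restrict`). -/

namespace AnisoMinkowski

/-! ### The Wulff shape and its support function. -/

section SupportFunction

variable {V : Type*} [NormedAddCommGroup V] [NormedSpace ℝ V] {n : ℕ}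
  [Fact (Module.finrank ℝ V = n + 1)] {Ω : V [⋀^Fin (n + 1)]→ₗ[ℝ] ℝ} {hΩ : Ω ≠ 0}
  {F : ⋀[ℝ]^n V → ℝ}

theorem dualFunctional_hodge (ξ : ⋀[ℝ]^n V) :
    dualFunctional Ω hΩ F (hodge Ω ξ) = F ξ := by
  have : hodge Ω ξ = hodgeEquiv Ω hΩ ξ := rfl
  rw [dualFunctional, this, LinearEquiv.symm_apply_apply]

theorem IsConvexDensity.convexOn_dualFunctional (hF : IsConvexDensity F) :
    ConvexOn ℝ univ (dualFunctional Ω hΩ F) :=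
  hF.convexOn.comp_linearMap (hodgeEquiv Ω hΩ).symm.toLinearMap

theorem IsConvexDensity.dualFunctional_smul (hF : IsConvexDensity F) {a : ℝ} (ha : 0 ≤ a)
    (f : Module.Dual ℝ V) : dualFunctional Ω hΩ F (a • f) = a * dualFunctional Ω hΩ F f := by
  rw [dualFunctional, map_smul, hF.homogeneous a ha, dualFunctional]

theorem IsConvexDensity.dualFunctional_zero (hF : IsConvexDensity F) :
    dualFunctional Ω hΩ F 0 = 0 := by
  simpa using hF.dualFunctional_smul (hΩ := hΩ) le_rfl 0

theorem IsConvexDensity.dualFunctional_pos (hF : IsConvexDensity F) {f : Module.Dual ℝ V}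
    (hf : f ≠ 0) : 0 < dualFunctional Ω hΩ F f :=
  hF.pos _ (by simpa using hf)

theorem IsConvexDensity.dualFunctional_nonneg (hF : IsConvexDensity F) (f : Module.Dual ℝ V) :
    0 ≤ dualFunctional Ω hΩ F f := by
  rcases eq_or_ne f 0 with rfl | hf
  · exact hF.dualFunctional_zero.ge
  · exact (hF.dualFunctional_pos hf).le

theorem IsConvexDensity.dualFunctional_add_le (hF : IsConvexDensity F) (f g : Module.Dual ℝ V) :
    dualFunctional Ω hΩ F (f + g) ≤ dualFunctional Ω hΩ F f + dualFunctional Ω hΩ F g := by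
  have h := (hF.convexOn_dualFunctional (hΩ := hΩ)).2 (mem_univ f) (mem_univ g)
    (show (0 : ℝ) ≤ 1 / 2 by norm_num) (show (0 : ℝ) ≤ 1 / 2 by norm_num) (by norm_num)
  rw [← smul_add, hF.dualFunctional_smul (by norm_num)] at h
  simp only [smul_eq_mul] at h
  linarith

variable [FiniteDimensional ℝ V]

theorem IsConvexDensity.continuous_dualFunctional (hF : IsConvexDensity F) :
    Continuous fun f : V →L[ℝ] ℝ => dualFunctional Ω hΩ F (f : V →ₗ[ℝ] ℝ) := by
  have h : ConvexOn ℝ univ fun f : V →L[ℝ] ℝ => dualFunctional Ω hΩ F (f : V →ₗ[ℝ] ℝ) :=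
    (hF.convexOn_dualFunctional (hΩ := hΩ)).comp_linearMap (ContinuousLinearMap.coeLM ℝ)
  exact continuousOn_univ.mp (h.continuousOn isOpen_univ)

/-- Continuity and positivity on the compact unit sphere, extended by homogeneity. The lower bound
makes the supremum in `primalFunctional` finite; the upper one makes the Wulff shape bounded. -/
theorem IsConvexDensity.exists_dualFunctional_bounds (hF : IsConvexDensity F) :
    ∃ c C : ℝ, 0 < c ∧ ∀ f : V →L[ℝ] ℝ, c * ‖f‖ ≤ dualFunctional Ω hΩ F (f : V →ₗ[ℝ] ℝ) ∧
      dualFunctional Ω hΩ F (f : V →ₗ[ℝ] ℝ) ≤ C * ‖f‖ := by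
  have hV : Module.finrank ℝ V = n + 1 := Fact.out
  have : Nontrivial V := Module.nontrivial_of_finrank_pos (R := ℝ) (by omega)
  have hK : IsCompact (Metric.sphere (0 : V →L[ℝ] ℝ) 1) := isCompact_sphere 0 1
  have hne : (Metric.sphere (0 : V →L[ℝ] ℝ) 1).Nonempty := NormedSpace.sphere_nonempty.mpr zero_le_one
  have hc := (hF.continuous_dualFunctional (hΩ := hΩ)).continuousOn (s := Metric.sphere 0 1)
  obtain ⟨f₀, hf₀, hmin⟩ := hK.exists_isMinOn hne hc
  obtain ⟨f₁, hf₁, hmax⟩ := hK.exists_isMaxOn hne hc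
  refine ⟨_, dualFunctional Ω hΩ F (f₁ : V →ₗ[ℝ] ℝ),
    hF.dualFunctional_pos (hΩ := hΩ) (f := (f₀ : V →ₗ[ℝ] ℝ)) ?_, fun f => ?_⟩
  · intro h
    have : f₀ = 0 := by ext v; exact LinearMap.congr_fun h v
    simp [this] at hf₀
  · rcases eq_or_ne f 0 with rfl | hf
    · simp [hF.dualFunctional_zero]
    have hn : 0 < ‖f‖ := norm_pos_iff.mpr hf
    have hmem : ‖f‖⁻¹ • f ∈ Metric.sphere (0 : V →L[ℝ] ℝ) 1 := by
      simp [norm_smul, hn.ne']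
    have hval : dualFunctional Ω hΩ F (f : V →ₗ[ℝ] ℝ) =
        dualFunctional Ω hΩ F ((‖f‖⁻¹ • f : V →L[ℝ] ℝ) : V →ₗ[ℝ] ℝ) * ‖f‖ := by
      rw [ContinuousLinearMap.toLinearMap_smul, hF.dualFunctional_smul (by positivity)]
      field_simp
    rw [hval]
    exact ⟨mul_le_mul_of_nonneg_right (hmin hmem) hn.le,
      mul_le_mul_of_nonneg_right (hmax hmem) hn.le⟩

theorem IsConvexDensity.mem_wulffShape_iff (hF : IsConvexDensity F) {v : V} :
    v ∈ wulffShape Ω hΩ F ↔ ∀ f : Module.Dual ℝ V, f v ≤ dualFunctional Ω hΩ F f := by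
  obtain ⟨c, C, hc, hb⟩ := hF.exists_dualFunctional_bounds (hΩ := hΩ)
  -- A real `⨆` over an unbounded family is `0` by default, so boundedness must be known before the
  -- supremum can be unfolded.
  have hbdd : BddAbove (range fun f : {f : Module.Dual ℝ V // dualFunctional Ω hΩ F f ≤ 1} =>
      (f : Module.Dual ℝ V) v) := by
    refine ⟨c⁻¹ * ‖v‖, ?_⟩
    rintro _ ⟨⟨f, hf⟩, rfl⟩
    have h1 := (hb (LinearMap.toContinuousLinearMap f)).1
    simp only [LinearMap.coe_toContinuousLinearMap] at h1
    have h2 : ‖LinearMap.toContinuousLinearMap f‖ ≤ c⁻¹ := by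
      rw [← one_div, le_div_iff₀' hc]; exact h1.trans hf
    calc f v ≤ ‖LinearMap.toContinuousLinearMap f v‖ := le_abs_self _
      _ ≤ ‖LinearMap.toContinuousLinearMap f‖ * ‖v‖ := ContinuousLinearMap.le_opNorm _ _
      _ ≤ _ := by gcongr
  have : Nonempty {f : Module.Dual ℝ V // dualFunctional Ω hΩ F f ≤ 1} :=
    ⟨⟨0, by rw [hF.dualFunctional_zero]; exact zero_le_one⟩⟩
  rw [wulffShape, mem_ofPred_eq, primalFunctional, ciSup_le_iff hbdd]
  constructor
  · intro h f
    rcases eq_or_ne f 0 with rfl | hf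
    · simp [hF.dualFunctional_zero]
    have hp := hF.dualFunctional_pos (hΩ := hΩ) hf
    have h1 := h ⟨(dualFunctional Ω hΩ F f)⁻¹ • f, by
      rw [hF.dualFunctional_smul (by positivity), inv_mul_cancel₀ hp.ne']⟩
    simp only [LinearMap.smul_apply, smul_eq_mul] at h1
    rwa [inv_mul_le_iff₀ hp, mul_one] at h1
  · rintro h ⟨f, hf⟩
    exact (h f).trans hf

theorem IsConvexDensity.zero_mem_wulffShape (hF : IsConvexDensity F) :
    (0 : V) ∈ wulffShape Ω hΩ F :=
  hF.mem_wulffShape_iff.mpr fun f => by simpa using hF.dualFunctional_nonneg f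

theorem IsConvexDensity.exists_norm_le_of_mem_wulffShape (hF : IsConvexDensity F) :
    ∃ R : ℝ, ∀ v ∈ wulffShape Ω hΩ F, ‖v‖ ≤ R := by
  obtain ⟨c, C, hc, hb⟩ := hF.exists_dualFunctional_bounds (hΩ := hΩ)
  refine ⟨max C 0, fun v hv => ?_⟩
  obtain ⟨f, hf, hfv⟩ := exists_dual_vector'' ℝ v
  have h1 : f v ≤ dualFunctional Ω hΩ F (f : V →ₗ[ℝ] ℝ) := hF.mem_wulffShape_iff.mp hv f
  have h2 : f v = ‖v‖ := by simpa using hfv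
  calc ‖v‖ = f v := h2.symm
    _ ≤ C * ‖f‖ := h1.trans (hb f).2
    _ ≤ max C 0 * ‖f‖ := by gcongr; exact le_max_left _ _
    _ ≤ max C 0 * 1 := by gcongr
    _ = _ := mul_one _

/-- The functional `dualFunctional` is the support function of the Wulff shape. -/
theorem IsConvexDensity.exists_mem_wulffShape_eq (hF : IsConvexDensity F) (f : Module.Dual ℝ V) :
    ∃ v ∈ wulffShape Ω hΩ F, f v = dualFunctional Ω hΩ F f := by
  obtain ⟨L, hL, hLle⟩ : ∃ L : Module.Dual ℝ (Module.Dual ℝ V),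
      L f = dualFunctional Ω hΩ F f ∧ ∀ g, L g ≤ dualFunctional Ω hΩ F g := by
    rcases eq_or_ne f 0 with rfl | hf
    · exact ⟨0, by simp [hF.dualFunctional_zero], fun g => by
        simpa using hF.dualFunctional_nonneg g⟩
    -- Hahn-Banach on the line through `f`: the extension is dominated by `dualFunctional`, and by
    -- reflexivity it is evaluation at a vector, which then lies in the Wulff shape.
    obtain ⟨L, h1, h2⟩ := exists_extension_of_le_sublinear
      (LinearPMap.mkSpanSingleton f (dualFunctional Ω hΩ F f) hf) (dualFunctional Ω hΩ F)
      (fun c hc x => hF.dualFunctional_smul hc.le x) (hF.dualFunctional_add_le) (by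
        rintro ⟨x, hx⟩
        obtain ⟨a, rfl⟩ := Submodule.mem_span_singleton.mp hx
        rw [LinearPMap.mkSpanSingleton'_apply, RingHom.id_apply, smul_eq_mul]
        rcases le_total 0 a with ha | ha
        · rw [hF.dualFunctional_smul ha]
        -- On negative multiples of `f` the functional is nonpositive while the bound is
        -- nonnegative, so symmetry is not needed.
        · exact (mul_nonpos_of_nonpos_of_nonneg ha (hF.dualFunctional_nonneg f)).trans
            (hF.dualFunctional_nonneg _))
    refine ⟨L, ?_, h2⟩
    have h3 := h1 ⟨f, Submodule.mem_span_singleton_self f⟩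
    rw [h3]
    have := LinearPMap.mkSpanSingleton_apply (K := ℝ) (L := ℝ) (σ := RingHom.id ℝ) (x := f) hf
      (dualFunctional Ω hΩ F f)
    simpa using this
  refine ⟨(Module.evalEquiv ℝ V).symm L, hF.mem_wulffShape_iff.mpr fun g => ?_, ?_⟩
  · simpa using hLle g
  · simpa using hL

end SupportFunction

/-! ### The layer over a subgraph in a product space. -/

section GraphDomain

variable {E : Type*} [NormedAddCommGroup E] [NormedSpace ℝ E]

/-- Inside the box `Y ×ˢ I`, the set `B` is the subgraph of the `C²` function `g`. -/
structure IsSubgraphOn (B : Set (E × ℝ)) (Y : Set E) (I : Set ℝ) (g : E → ℝ) (L : NNReal) :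
    Prop where
  isOpen_base : IsOpen Y
  isBounded_base : Bornology.IsBounded Y
  isOpen_fiber : IsOpen I
  mapsTo : MapsTo g Y I
  contDiffOn : ContDiffOn ℝ 2 g Y
  lipschitzOnWith : LipschitzOnWith L g Y
  mem_iff : ∀ y ∈ Y, ∀ s ∈ I, (y, s) ∈ B ↔ s < g y

theorem mem_add_smul_iff {M : Type*} [AddCommGroup M] [Module ℝ M] {B W : Set M} {t : ℝ} {x : M} :
    x ∈ B + t • W ↔ ∃ w ∈ W, x - t • w ∈ B := by
  constructor
  · rintro ⟨b, hb, _, ⟨w, hw, rfl⟩, rfl⟩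
    exact ⟨w, hw, by simpa using hb⟩
  · rintro ⟨w, hw, h⟩
    exact ⟨_, h, _, ⟨w, hw, rfl⟩, by simp⟩

/-- A compact set has a positive distance from the complement of an open neighbourhood. Used with
the support of a test function inside the box, so that the subgraph description also applies to the
shifted points. -/
theorem exists_forall_sub_smul_mem {M : Type*} [NormedAddCommGroup M] [NormedSpace ℝ M]
    {K O W : Set M} {R : ℝ} (hK : IsCompact K) (hO : IsOpen O) (hKO : K ⊆ O)
    (hR : ∀ w ∈ W, ‖w‖ ≤ R) :
    ∀ᶠ t in 𝓝[>] (0 : ℝ), ∀ x ∈ K, ∀ w ∈ W, x - t • w ∈ O := by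
  obtain ⟨δ, hδ, hδO⟩ := hK.exists_thickening_subset_open hO hKO
  have hlim : Tendsto (fun t : ℝ => t * R) (𝓝[>] 0) (𝓝 0) := by
    have : Tendsto (fun t : ℝ => t * R) (𝓝 0) (𝓝 (0 * R)) := tendsto_id.mul_const R
    rw [zero_mul] at this
    exact this.mono_left nhdsWithin_le_nhds
  filter_upwards [hlim.eventually (gt_mem_nhds hδ), self_mem_nhdsWithin] with t ht ht0 x hx w hw
  refine hδO (Metric.mem_thickening_iff.mpr ⟨x, hx, ?_⟩)
  rw [dist_eq_norm, sub_sub_cancel_left, norm_neg, norm_smul, Real.norm_of_nonneg (le_of_lt ht0)]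
  exact (mul_le_mul_of_nonneg_left (hR w hw) (le_of_lt ht0)).trans_lt ht

variable {B W : Set (E × ℝ)} {Y : Set E} {I : Set ℝ} {g : E → ℝ} {L : NNReal} {R : ℝ}
  {φ : E × ℝ → ℝ}

/-- In the rescaled height `r` over the graph, the shifted point lies in `B` exactly when `r` is
below `w.2` plus a difference quotient of `g`. This turns the shape of the layer into a statement
about derivatives. -/
theorem IsSubgraphOn.mem_diff_iff (hG : IsSubgraphOn B Y I g L) {t : ℝ} (ht : 0 < t)
    {y : E} {r : ℝ} (hy : y ∈ Y) (hr : g y + t * r ∈ I)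
    (hw : ∀ w ∈ W, ((y, g y + t * r) : E × ℝ) - t • w ∈ Y ×ˢ I) :
    (y, g y + t * r) ∈ (B + t • W) \ B ↔
      0 ≤ r ∧ ∃ w ∈ W, r < w.2 + (g (y - t • w.1) - g y) / t := by
  rw [Set.mem_sdiff, and_comm, hG.mem_iff y hy _ hr, mem_add_smul_iff]
  refine and_congr ?_ (exists_congr fun w => and_congr_right fun hwW => ?_)
  · rw [not_lt, le_add_iff_nonneg_right, mul_nonneg_iff_of_pos_left ht]
  · have h := hw w hwW
    rw [mem_prod] at h
    have h' : ((y, g y + t * r) : E × ℝ) - t • w = (y - t • w.1, g y + t * r - t * w.2) := rfl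
    rw [h'] at h ⊢
    rw [hG.mem_iff _ h.1 _ h.2, ← sub_lt_iff_lt_add', lt_div_iff₀ ht]
    constructor <;> intro h <;> nlinarith

theorem IsSubgraphOn.eventually_abs_slope_sub_le (hG : IsSubgraphOn B Y I g L) {y : E}
    (hy : y ∈ Y) (hR : ∀ w ∈ W, ‖w‖ ≤ R) {ε : ℝ} (hε : 0 < ε) :
    ∀ᶠ t in 𝓝[>] (0 : ℝ), ∀ w ∈ W,
      |(g (y - t • w.1) - g y) / t + fderiv ℝ g y w.1| ≤ ε := by
  have hd : HasFDerivAt g (fderiv ℝ g y) y :=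
    ((hG.contDiffOn.contDiffAt (hG.isOpen_base.mem_nhds hy)).differentiableAt
      (by norm_num)).hasFDerivAt
  -- `R` may be nonpositive, and `ε / R'` has to be a positive constant in the little-o estimate;
  -- one such constant serves all `w ∈ W`.
  set R' := max R 1
  have hR' : 0 < R' := by positivity
  rw [hasFDerivAt_iff_isLittleO_nhds_zero] at hd
  have h1 := hd.def (div_pos hε hR')
  obtain ⟨δ, hδ, hball⟩ := Metric.eventually_nhds_iff_ball.mp h1
  have hlim : Tendsto (fun t : ℝ => t * R') (𝓝[>] 0) (𝓝 0) := by
    have : Tendsto (fun t : ℝ => t * R') (𝓝 0) (𝓝 (0 * R')) := tendsto_id.mul_const R'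
    rw [zero_mul] at this
    exact this.mono_left nhdsWithin_le_nhds
  filter_upwards [hlim.eventually (gt_mem_nhds hδ), self_mem_nhdsWithin] with t ht ht0 w hw
  have ht0 : 0 < t := ht0
  have hn : ‖-(t • w.1)‖ ≤ t * R' := by
    rw [norm_neg, norm_smul, Real.norm_of_nonneg ht0.le]
    exact mul_le_mul_of_nonneg_left
      (((norm_fst_le w).trans (hR w hw)).trans (le_max_left _ _)) ht0.le
  have h2 := hball (-(t • w.1)) (by simpa using hn.trans_lt ht)
  have h3 : (g (y - t • w.1) - g y) / t + fderiv ℝ g y w.1 =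
      (g (y + -(t • w.1)) - g y - fderiv ℝ g y (-(t • w.1))) / t := by
    rw [map_neg, map_smul, smul_eq_mul, ← sub_eq_add_neg]
    field_simp
    ring
  rw [h3, abs_div, abs_of_pos ht0, div_le_iff₀ ht0]
  calc _ ≤ ε / R' * ‖-(t • w.1)‖ := h2
    _ ≤ ε / R' * (t * R') := by gcongr
    _ = ε * t := by field_simp

theorem IsSubgraphOn.slope_le (hG : IsSubgraphOn B Y I g L) {y : E} (hy : y ∈ Y)
    (hR : ∀ w ∈ W, ‖w‖ ≤ R) {t : ℝ} (ht : 0 < t) {w : E × ℝ} (hw : w ∈ W)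
    (hwY : y - t • w.1 ∈ Y) :
    w.2 + (g (y - t • w.1) - g y) / t ≤ (1 + L) * R := by
  have h1 : w.2 ≤ R := (le_abs_self _).trans ((norm_snd_le w).trans (hR w hw))
  have h2 : g (y - t • w.1) - g y ≤ L * (t * R) := by
    have h3 := hG.lipschitzOnWith.dist_le_mul _ hwY _ hy
    rw [Real.dist_eq, dist_eq_norm, sub_sub_cancel_left, norm_neg, norm_smul,
      Real.norm_of_nonneg ht.le] at h3
    refine (le_abs_self _).trans (h3.trans ?_)
    gcongr
    exact (norm_fst_le w).trans (hR w hw)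
  have h4 : (g (y - t • w.1) - g y) / t ≤ L * R := by
    rw [div_le_iff₀ ht]; linarith
  linarith

/-- The Lipschitz bound on `g` confines the rescaled layer to a fixed interval of heights. The bound
depends on neither `t` nor `y`, so it dominates in both the fibre and the base integral. -/
theorem IsSubgraphOn.eventually_norm_indicator_le (hG : IsSubgraphOn B Y I g L)
    (hR : ∀ w ∈ W, ‖w‖ ≤ R) (hφc : HasCompactSupport φ) (hφs : tsupport φ ⊆ Y ×ˢ I)
    {M : ℝ} (hM : ∀ x, ‖φ x‖ ≤ M) :
    ∀ᶠ t in 𝓝[>] (0 : ℝ), ∀ y r,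
      ‖((B + t • W) \ B).indicator φ (y, g y + t * r)‖ ≤
        (Icc 0 ((1 + L) * R)).indicator (fun _ => M) r := by
  filter_upwards [exists_forall_sub_smul_mem hφc (hG.isOpen_base.prod hG.isOpen_fiber) hφs hR,
    self_mem_nhdsWithin] with t ht ht0 y r
  have ht0 : 0 < t := ht0
  have hM0 : 0 ≤ M := (norm_nonneg _).trans (hM 0)
  have hpos : 0 ≤ (Icc 0 ((1 + L) * R)).indicator (fun _ => M) r :=
    indicator_nonneg (fun _ _ => hM0) _
  by_cases hmem : (y, g y + t * r) ∈ (B + t • W) \ B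
  swap
  · rw [indicator_of_notMem hmem, norm_zero]; exact hpos
  by_cases hx : (y, g y + t * r) ∈ tsupport φ
  swap
  · rw [indicator_of_mem hmem, image_eq_zero_of_notMem_tsupport hx, norm_zero]; exact hpos
  have hyI := hφs hx
  rw [mem_prod] at hyI
  obtain ⟨h0, w, hw, hlt⟩ := (hG.mem_diff_iff ht0 hyI.1 hyI.2 (ht _ hx)).mp hmem
  have hr : r ∈ Icc 0 ((1 + L) * R) :=
    ⟨h0, hlt.le.trans (hG.slope_le hyI.1 hR ht0 hw (mem_prod.mp (ht _ hx w hw)).1)⟩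
  rw [indicator_of_mem hmem, indicator_of_mem hr]
  exact hM _

/-- Below `h` some single `w` has slope beyond `r`, and above `h` none has; the first-order error is
eventually at most half the gap, uniformly in `w`. At `r = h` first-order information does not
decide, hence the exclusion. -/
theorem IsSubgraphOn.tendsto_indicator (hG : IsSubgraphOn B Y I g L)
    (hR : ∀ w ∈ W, ‖w‖ ≤ R) (hφ : Continuous φ) (hφc : HasCompactSupport φ)
    (hφs : tsupport φ ⊆ Y ×ˢ I) {y : E} (hy : y ∈ Y) {h : ℝ}
    (hh : IsLUB ((fun w : E × ℝ => w.2 - fderiv ℝ g y w.1) '' W) h) {r : ℝ} (hr : r ≠ h) :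
    Tendsto (fun t : ℝ => ((B + t • W) \ B).indicator φ (y, g y + t * r)) (𝓝[>] 0)
      (𝓝 ((Ico 0 h).indicator (fun _ => φ (y, g y)) r)) := by
  have hK := exists_forall_sub_smul_mem hφc (hG.isOpen_base.prod hG.isOpen_fiber) hφs hR
  by_cases hr' : r ∈ Ico 0 h
  · rw [indicator_of_mem hr']
    have hlim : Tendsto (fun t : ℝ => φ (y, g y + t * r)) (𝓝[>] 0) (𝓝 (φ (y, g y))) := by
      have : Continuous fun t : ℝ => φ (y, g y + t * r) := by fun_prop
      have h2 := this.tendsto 0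
      simp only [zero_mul, add_zero] at h2
      exact h2.mono_left nhdsWithin_le_nhds
    refine hlim.congr' ?_
    obtain ⟨_, ⟨w, hw, rfl⟩, hrw⟩ := (lt_isLUB_iff hh).mp hr'.2
    filter_upwards [hK, self_mem_nhdsWithin,
      hG.eventually_abs_slope_sub_le hy hR (half_pos (sub_pos.mpr hrw))] with t ht ht0 hslope
    by_cases hx : (y, g y + t * r) ∈ tsupport φ
    swap
    · rw [image_eq_zero_of_notMem_tsupport hx]
      exact (indicator_apply_eq_zero.mpr fun _ => image_eq_zero_of_notMem_tsupport hx).symm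
    rw [indicator_of_mem]
    refine (hG.mem_diff_iff ht0 hy (mem_prod.mp (hφs hx)).2 (ht _ hx)).mpr ⟨hr'.1, w, hw, ?_⟩
    have := (abs_le.mp (hslope w hw)).1
    simp only at hrw
    linarith
  · rw [indicator_of_notMem hr']
    refine tendsto_const_nhds.congr' ?_
    rw [mem_Ico, not_and_or, not_le, not_lt] at hr'
    rcases hr' with hneg | hge
    · filter_upwards [hK, self_mem_nhdsWithin] with t ht ht0
      refine (indicator_apply_eq_zero.mpr fun hmem => ?_).symm
      by_contra hne
      have hx := subset_tsupport φ hne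
      have := (hG.mem_diff_iff ht0 hy (mem_prod.mp (hφs hx)).2 (ht _ hx)).mp hmem
      exact absurd this.1 (not_le.mpr hneg)
    · have hlt : h < r := lt_of_le_of_ne hge (Ne.symm hr)
      filter_upwards [hK, self_mem_nhdsWithin,
        hG.eventually_abs_slope_sub_le hy hR (half_pos (sub_pos.mpr hlt))] with t ht ht0 hslope
      refine (indicator_apply_eq_zero.mpr fun hmem => ?_).symm
      by_contra hne
      have hx := subset_tsupport φ hne
      obtain ⟨-, w, hw, hrw⟩ := (hG.mem_diff_iff ht0 hy (mem_prod.mp (hφs hx)).2 (ht _ hx)).mp hmem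
      have h1 := (abs_le.mp (hslope w hw)).2
      have h2 : w.2 - fderiv ℝ g y w.1 ≤ h := hh.1 ⟨w, hw, rfl⟩
      linarith

theorem inv_mul_integral_eq_integral_comp_add_mul {t : ℝ} (ht : 0 < t) (f : ℝ → ℝ) (a : ℝ) :
    t⁻¹ * ∫ s, f s = ∫ r, f (a + t * r) := by
  rw [Measure.integral_comp_mul_left (fun r => f (a + r)) t, integral_add_left_eq_self,
    abs_of_pos (inv_pos.mpr ht), smul_eq_mul]

theorem IsSubgraphOn.tendsto_slice (hG : IsSubgraphOn B Y I g L) [MeasurableSpace E]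
    [BorelSpace E] [FiniteDimensional ℝ E] (hB : IsOpen B)
    (hR : ∀ w ∈ W, ‖w‖ ≤ R) (hφ : Continuous φ) (hφc : HasCompactSupport φ)
    (hφs : tsupport φ ⊆ Y ×ˢ I) {y : E} (hy : y ∈ Y) {h : ℝ} (h0 : 0 ≤ h)
    (hh : IsLUB ((fun w : E × ℝ => w.2 - fderiv ℝ g y w.1) '' W) h) :
    Tendsto (fun t : ℝ => t⁻¹ * ∫ s, ((B + t • W) \ B).indicator φ (y, s)) (𝓝[>] 0)
      (𝓝 (φ (y, g y) * h)) := by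
  obtain ⟨M, hM⟩ := hφ.bounded_above_of_compact_support hφc
  have hlim : Tendsto (fun t : ℝ => ∫ r, ((B + t • W) \ B).indicator φ (y, g y + t * r)) (𝓝[>] 0)
      (𝓝 (∫ r, (Ico 0 h).indicator (fun _ => φ (y, g y)) r)) := by
    refine tendsto_integral_filter_of_dominated_convergence
      ((Icc 0 ((1 + L) * R)).indicator (fun _ => M)) ?_ ?_ ?_ ?_
    · refine Eventually.of_forall fun t => Measurable.aestronglyMeasurable ?_
      have hD : MeasurableSet ((B + t • W) \ B) :=
        (hB.add_right).measurableSet.diff hB.measurableSet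
      exact (hφ.measurable.indicator hD).comp (by fun_prop)
    · filter_upwards [hG.eventually_norm_indicator_le hR hφc hφs hM] with t ht
      exact Eventually.of_forall (ht y)
    · exact (integrable_indicator_iff measurableSet_Icc).mpr
        (integrableOn_const (by simp) (by simp))
    · filter_upwards [Measure.ae_ne volume h] with r hr
      exact hG.tendsto_indicator hR hφ hφc hφs hy hh hr
  have hval : ∫ r, (Ico 0 h).indicator (fun _ => φ (y, g y)) r = φ (y, g y) * h := by
    rw [integral_indicator measurableSet_Ico, setIntegral_const, Real.volume_real_Ico, sub_zero,
      max_eq_left h0, smul_eq_mul, mul_comm]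
  rw [hval] at hlim
  refine hlim.congr' ?_
  filter_upwards [self_mem_nhdsWithin] with t ht
  exact (inv_mul_integral_eq_integral_comp_add_mul ht
    (fun s => ((B + t • W) \ B).indicator φ (y, s)) (g y)).symm

/-- The localized volume of `(B + tW) \ B`, divided by `t`, converges to the integral over the
base of the height of `W` above the tangent plane of the graph. -/
theorem IsSubgraphOn.tendsto_integral (hG : IsSubgraphOn B Y I g L) [MeasurableSpace E]
    [BorelSpace E] [FiniteDimensional ℝ E] (μ : Measure E) [IsFiniteMeasureOnCompacts μ]
    (hB : IsOpen B) (hR : ∀ w ∈ W, ‖w‖ ≤ R) (hφ : Continuous φ) (hφc : HasCompactSupport φ)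
    (hφs : tsupport φ ⊆ Y ×ˢ I) {h : E → ℝ} (h0 : ∀ y ∈ Y, 0 ≤ h y)
    (hh : ∀ y ∈ Y, IsLUB ((fun w : E × ℝ => w.2 - fderiv ℝ g y w.1) '' W) (h y)) :
    Tendsto (fun t : ℝ => t⁻¹ * ∫ x in (B + t • W) \ B, φ x ∂(μ.prod volume)) (𝓝[>] 0)
      (𝓝 (∫ y in Y, φ (y, g y) * h y ∂μ)) := by
  obtain ⟨M, hM⟩ := hφ.bounded_above_of_compact_support hφc
  have hD : ∀ t : ℝ, MeasurableSet ((B + t • W) \ B) := fun t =>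
    (hB.add_right).measurableSet.diff hB.measurableSet
  have hint : ∀ t : ℝ, Integrable (((B + t • W) \ B).indicator φ) (μ.prod volume) := fun t =>
    (hφ.integrable_of_hasCompactSupport hφc).indicator (hD t)
  have hYfin : μ Y < ∞ := hG.isBounded_base.measure_lt_top
  -- Fubini; fibres over points outside `Y` drop out because they miss the support of `φ`.
  have key : ∀ t : ℝ, t⁻¹ * ∫ x in (B + t • W) \ B, φ x ∂(μ.prod volume) =
      ∫ y in Y, (t⁻¹ * ∫ s, ((B + t • W) \ B).indicator φ (y, s)) ∂μ := by
    intro t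
    rw [← integral_indicator (hD t), integral_prod _ (hint t), integral_const_mul]
    congr 1
    refine (setIntegral_eq_integral_of_forall_compl_eq_zero fun y hy => ?_).symm
    refine (integral_congr_ae (Eventually.of_forall fun s => ?_)).trans (integral_zero _ _)
    refine indicator_apply_eq_zero.mpr fun _ => image_eq_zero_of_notMem_tsupport fun hx => ?_
    exact hy (mem_prod.mp (hφs hx)).1
  simp_rw [key]
  -- The dominating function is a constant, integrable because the bounded base `Y` has finite
  -- measure.
  refine tendsto_integral_filter_of_dominated_convergence
    (fun _ => ∫ r, (Icc 0 ((1 + L) * R)).indicator (fun _ => M) r) ?_ ?_ ?_ ?_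
  · exact Eventually.of_forall fun t =>
      ((hint t).aestronglyMeasurable.integral_prod_right'.const_mul _).restrict
  · filter_upwards [hG.eventually_norm_indicator_le hR hφc hφs hM, self_mem_nhdsWithin]
      with t ht ht0
    refine Eventually.of_forall fun y => ?_
    rw [inv_mul_integral_eq_integral_comp_add_mul ht0 _ (g y)]
    refine norm_integral_le_of_norm_le ?_ (Eventually.of_forall (ht y))
    exact (integrable_indicator_iff measurableSet_Icc).mpr
      (integrableOn_const (by simp) (by simp))
  · exact integrableOn_const hYfin.ne enorm_ne_top
  · filter_upwards [ae_restrict_mem hG.isOpen_base.measurableSet] with y hy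
    exact hG.tendsto_slice hB hR hφ hφc hφs hy (h0 y hy) (hh y hy)

end GraphDomain

/-! ### Tangent vectors, conormals and volume in graph coordinates. -/

section GraphLinearAlgebra

variable {V : Type*} [NormedAddCommGroup V] [NormedSpace ℝ V] {n : ℕ}

/-- Shears along `e` do not change the volume, since `e` is already an argument. The induction adds
the multiples of `e` one column at a time. -/
theorem map_vecCons_add_smul (Ω : V [⋀^Fin (n + 1)]→ₗ[ℝ] ℝ) (e : V) (b : Fin n → V)
    (a : Fin n → ℝ) :
    Ω (Matrix.vecCons e fun i => b i + a i • e) = Ω (Matrix.vecCons e b) := by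
  have key : ∀ S : Finset (Fin n),
      Ω (Matrix.vecCons e fun i => b i + (if i ∈ S then a i else 0) • e) =
        Ω (Matrix.vecCons e b) := by
    intro S
    induction S using Finset.induction_on with
    | empty => simp
    | insert j S hj ih =>
      set v : Fin n → V := fun i => b i + (if i ∈ S then a i else 0) • e with hv
      have h1 : (Matrix.vecCons e fun i => b i + (if i ∈ insert j S then a i else 0) • e) =
          Function.update (Matrix.vecCons e v) j.succ (v j + a j • e) := by
        funext i
        refine Fin.cases ?_ (fun k => ?_) i
        · rw [Function.update_of_ne (Fin.succ_ne_zero j).symm]; rfl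
        · rcases eq_or_ne k j with rfl | hk
          · simp [hv, hj]
          · rw [Function.update_of_ne (by simpa using hk)]
            simp [hv, hk]
      have h2 : Function.update (Matrix.vecCons e v) j.succ (v j) = Matrix.vecCons e v := by
        rw [Function.update_eq_self_iff]; simp
      have h3 : Ω (Function.update (Matrix.vecCons e v) j.succ e) = 0 :=
        Ω.map_eq_zero_of_eq _ (i := 0) (j := j.succ)
          (by rw [Function.update_self, Function.update_of_ne (Fin.succ_ne_zero j).symm,
            Matrix.cons_val_zero]) (Fin.succ_ne_zero j).symm
      rw [h1, Ω.map_update_add, h2, Ω.map_update_smul, h3, smul_zero, add_zero, ih]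
  simpa using key Finset.univ

/-- The direction in which the boundary is a graph, in the linear coordinates `A`. -/
def axis (A : ((Fin n → ℝ) × ℝ) ≃L[ℝ] V) : V := A (0, 1)

/-- The volume of the coordinate frame of `A`. -/
def frameVolume (Ω : V [⋀^Fin (n + 1)]→ₗ[ℝ] ℝ) (A : ((Fin n → ℝ) × ℝ) ≃L[ℝ] V) : ℝ :=
  Ω (Matrix.vecCons (axis A) fun i => A (Pi.single i 1, 0))

/-- The parametrization of a graph, in the linear coordinates `A`. -/
def graphMap (A : ((Fin n → ℝ) × ℝ) ≃L[ℝ] V) (g : (Fin n → ℝ) → ℝ) (y : Fin n → ℝ) : V :=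
  A (y, g y)

/-- The functional `(y, s) ↦ s - g' y` in the linear coordinates `A`. -/
noncomputable def graphConormal (A : ((Fin n → ℝ) × ℝ) ≃L[ℝ] V) (g' : (Fin n → ℝ) →L[ℝ] ℝ) :
    V →L[ℝ] ℝ :=
  (ContinuousLinearMap.snd ℝ (Fin n → ℝ) ℝ - g'.comp (ContinuousLinearMap.fst ℝ (Fin n → ℝ) ℝ)).comp
    (A.symm : V →L[ℝ] (Fin n → ℝ) × ℝ)

variable {A : ((Fin n → ℝ) × ℝ) ≃L[ℝ] V} {g : (Fin n → ℝ) → ℝ} {g' : (Fin n → ℝ) →L[ℝ] ℝ}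
  {y : Fin n → ℝ} {Ω : V [⋀^Fin (n + 1)]→ₗ[ℝ] ℝ}

theorem graphConormal_apply (x : V) :
    graphConormal A g' x = (A.symm x).2 - g' (A.symm x).1 := rfl

theorem graphConormal_axis : graphConormal A g' (axis A) = 1 := by
  simp [graphConormal_apply, axis]

theorem hasFDerivAt_graphMap (hg : HasFDerivAt g g' y) :
    HasFDerivAt (graphMap A g)
      ((A : (Fin n → ℝ) × ℝ →L[ℝ] V).comp ((ContinuousLinearMap.id ℝ _).prod g')) y :=
  (A : (Fin n → ℝ) × ℝ →L[ℝ] V).hasFDerivAt.comp y ((hasFDerivAt_id y).prodMk hg)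

theorem partialDeriv_graphMap (hg : HasFDerivAt g g' y) :
    partialDeriv (graphMap A g) y =
      fun i => A (Pi.single i 1, 0) + g' (Pi.single i 1) • axis A := by
  funext i
  rw [partialDeriv, (hasFDerivAt_graphMap hg).fderiv, axis, ← map_smul, ← map_add]
  simp

theorem map_vecCons_axis_partialDeriv_graphMap (hg : HasFDerivAt g g' y) :
    Ω (Matrix.vecCons (axis A) (partialDeriv (graphMap A g) y)) = frameVolume Ω A := by
  rw [partialDeriv_graphMap hg, map_vecCons_add_smul, frameVolume]

/-- With `η` fixed and pulled back along `T`, `Ω` is an `n`-form on `ℝⁿ`, hence a multiple of the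
determinant. -/
theorem map_vecCons_comp (Ω : V [⋀^Fin (n + 1)]→ₗ[ℝ] ℝ) (η : V) (T : (Fin n → ℝ) →L[ℝ] V)
    (D : (Fin n → ℝ) →L[ℝ] (Fin n → ℝ)) :
    Ω (Matrix.vecCons η fun i => T (D (Pi.single i 1))) =
      D.det * Ω (Matrix.vecCons η fun i => T (Pi.single i 1)) := by
  set ω := (Ω.curryLeft η).compLinearMap (T : (Fin n → ℝ) →ₗ[ℝ] V) with hω
  have h1 := ω.eq_smul_basis_det (Pi.basisFun ℝ (Fin n))
  have h2 := congrArg (fun u : (Fin n → ℝ) [⋀^Fin n]→ₗ[ℝ] ℝ =>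
    u ((D : (Fin n → ℝ) →ₗ[ℝ] _) ∘ Pi.basisFun ℝ (Fin n))) h1
  simp only [AlternatingMap.smul_apply, Module.Basis.det_comp, Module.Basis.det_self] at h2
  have h3 : ω ((D : (Fin n → ℝ) →ₗ[ℝ] _) ∘ Pi.basisFun ℝ (Fin n)) =
      Ω (Matrix.vecCons η fun i => T (D (Pi.single i 1))) := by
    simp [hω, Function.comp_def]
  have h4 : ω (Pi.basisFun ℝ (Fin n)) = Ω (Matrix.vecCons η fun i => T (Pi.single i 1)) := by
    simp [hω]
  rw [h3, h4] at h2
  rw [h2, smul_eq_mul, mul_one, mul_comm]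

/-- Both sides are linear in `η`, vanish on vectors tangent to the graph, and agree on `axis A`,
which together with the tangent vectors spans `V`. -/
theorem map_vecCons_partialDeriv_graphMap (hg : HasFDerivAt g g' y) (η : V) :
    Ω (Matrix.vecCons η (partialDeriv (graphMap A g) y)) =
      graphConormal A g' η * frameVolume Ω A := by
  set T := (A : (Fin n → ℝ) × ℝ →L[ℝ] V).comp ((ContinuousLinearMap.id ℝ _).prod g') with hT
  have hP : partialDeriv (graphMap A g) y = fun i => T (Pi.single i 1) := by
    funext i; rw [partialDeriv, (hasFDerivAt_graphMap hg).fderiv]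
  set v := (A.symm η).1
  have hη : η = graphConormal A g' η • axis A + ∑ i, v i • T (Pi.single i 1) := by
    have h1 : ∑ i, v i • T (Pi.single i 1) = T v := by
      have h2 : v = ∑ i, v i • Pi.single i (1 : ℝ) := by
        ext j; simp [Finset.sum_apply, Pi.single_apply]
      conv_rhs => rw [h2]
      rw [map_sum]
      exact Finset.sum_congr rfl fun i _ => (map_smul T _ _).symm
    rw [h1]
    apply A.symm.injective
    simp [hT, axis, graphConormal_apply, v]
  let lam : V →ₗ[ℝ] ℝ := hodge Ω (exteriorPower.ιMulti ℝ n (partialDeriv (graphMap A g) y))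
  have hlam : ∀ x, lam x = Ω (Matrix.vecCons x (partialDeriv (graphMap A g) y)) := fun x =>
    hodge_ιMulti Ω _ x
  have h0 : ∀ i, lam (T (Pi.single i 1)) = 0 := by
    intro i
    rw [hlam]
    refine Ω.map_eq_zero_of_eq _ (i := 0) (j := i.succ) ?_ (Fin.succ_ne_zero i).symm
    simp [hP]
  rw [← hlam]
  conv_lhs => rw [hη]
  rw [map_add, map_sum, map_smul, hlam, map_vecCons_axis_partialDeriv_graphMap hg]
  simp [h0]

variable [FiniteDimensional ℝ V] [MeasurableSpace V] [BorelSpace V]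
  [Fact (Module.finrank ℝ V = n + 1)]

/-- Two Haar measures are proportional; the factor is read off from the image of the unit cube under
`A`. -/
theorem measure_eq_smul_map (Ω : V [⋀^Fin (n + 1)]→ₗ[ℝ] ℝ)
    (A : ((Fin n → ℝ) × ℝ) ≃L[ℝ] V) :
    Ω.measure = ENNReal.ofReal |frameVolume Ω A| • (volume : Measure ((Fin n → ℝ) × ℝ)).map A := by
  set ν := (volume : Measure ((Fin n → ℝ) × ℝ)).map A
  have : (volume : Measure ((Fin n → ℝ) × ℝ)).IsAddHaarMeasure := by
    rw [Measure.volume_eq_prod]; infer_instance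
  have : ν.IsAddHaarMeasure := A.isAddHaarMeasure_map volume
  have h := Measure.isAddLeftInvariant_eq_smul Ω.measure ν
  have hpar : parallelepiped (Matrix.vecCons (axis A) fun i => A (Pi.single i 1, 0)) =
      A '' (Icc 0 1 ×ˢ Icc 0 1) := by
    ext x
    rw [mem_parallelepiped_iff]
    constructor
    · rintro ⟨t, ht, rfl⟩
      refine ⟨(fun i => t i.succ, t 0), ⟨⟨fun i => ht.1 _, fun i => ht.2 _⟩, ht.1 0, ht.2 0⟩, ?_⟩
      rw [Fin.sum_univ_succ]
      simp only [Matrix.cons_val_zero, Matrix.cons_val_succ, axis, ← map_smul, ← map_sum, ← map_add]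
      congr 1
      ext1
      · ext j
        simp [Prod.fst_sum, Finset.sum_apply, Pi.single_apply]
      · simp [Prod.snd_sum]
    · rintro ⟨⟨u, s⟩, ⟨hu, hs⟩, rfl⟩
      refine ⟨Fin.cons s u, ⟨fun i => ?_, fun i => ?_⟩, ?_⟩
      · refine Fin.cases ?_ (fun j => ?_) i
        · simpa using hs.1
        · simpa using hu.1 j
      · refine Fin.cases ?_ (fun j => ?_) i
        · simpa using hs.2
        · simpa using hu.2 j
      rw [Fin.sum_univ_succ]
      simp only [Matrix.cons_val_zero, Matrix.cons_val_succ, axis, ← map_smul, ← map_sum, ← map_add,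
        Fin.cons_zero, Fin.cons_succ]
      congr 1
      ext1
      · ext j
        simp [Prod.fst_sum, Finset.sum_apply, Pi.single_apply]
      · simp [Prod.snd_sum]
  have h1 := Ω.measure_parallelepiped (Matrix.vecCons (axis A) fun i => A (Pi.single i 1, 0))
  have h2 : ν (A '' (Icc 0 1 ×ˢ Icc 0 1)) = 1 := by
    rw [show ν = volume.map A from rfl,
      show (A : (Fin n → ℝ) × ℝ → V) = A.toHomeomorph.toMeasurableEquiv from rfl,
      MeasurableEquiv.map_apply, MeasurableEquiv.preimage_image, Measure.volume_eq_prod,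
      Measure.prod_prod, Real.volume_Icc_pi]
    simp
  rw [hpar, h, Measure.smul_apply, h2] at h1
  rw [h]
  have h3 : (ENNReal.ofReal |frameVolume Ω A|) =
      (Measure.addHaarScalarFactor Ω.measure ν : ℝ≥0∞) := by
    rw [frameVolume, ← h1, ENNReal.smul_def, smul_eq_mul, mul_one]
  rw [h3]
  rfl

end GraphLinearAlgebra

/-! ### Outward vectors and independence of the defining function. -/

section Outward

variable {V : Type*} [NormedAddCommGroup V] [NormedSpace ℝ V] {B O O' : Set V} {ρ ρ' : V → ℝ}
  {p w : V}

theorem IsDefiningFunction.differentiableAt (h : IsDefiningFunction B O ρ) (hp : p ∈ O) :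
    DifferentiableAt ℝ ρ p :=
  (h.contDiffOn.contDiffAt (h.isOpen.mem_nhds hp)).differentiableAt (by norm_num)

theorem IsDefiningFunction.mem_iff (h : IsDefiningFunction B O ρ) {x : V} (hx : x ∈ O) :
    x ∈ B ↔ ρ x < 0 := by
  have := congrArg (x ∈ ·) h.inter_eq
  simpa [hx] using this

theorem IsDefiningFunction.eq_zero (h : IsDefiningFunction B O ρ) (hB : IsOpen B) (hp : p ∈ O)
    (hpB : p ∈ frontier B) : ρ p = 0 := by
  rw [hB.frontier_eq] at hpB
  refine le_antisymm ?_ (not_lt.mp fun hlt => hpB.2 ((h.mem_iff hp).mpr hlt))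
  by_contra hlt
  rw [not_le] at hlt
  have h1 : ∀ᶠ x in 𝓝 p, x ∉ B := by
    filter_upwards [(h.differentiableAt hp).continuousAt.eventually (lt_mem_nhds hlt),
      h.isOpen.mem_nhds hp] with x hx hxO hxB
    exact lt_asymm hx ((h.mem_iff hxO).mp hxB)
  obtain ⟨x, hx1, hx2⟩ := (mem_closure_iff_frequently.mp hpB.1).and_eventually h1 |>.exists
  exact hx2 hx1

theorem eventually_neg_along {f : V → ℝ} {f' : V →L[ℝ] ℝ}
    (hf : HasFDerivAt f f' p) (h0 : f p = 0) (hw : f' w < 0) :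
    ∀ᶠ t in 𝓝[>] (0 : ℝ), f (p + t • w) < 0 := by
  have h1 : HasDerivAt (fun t : ℝ => f (p + t • w)) (f' w) 0 := by
    have h2 : HasDerivAt (fun t : ℝ => p + t • w) w 0 := by
      simpa using ((hasDerivAt_id (0 : ℝ)).smul_const w).const_add p
    have hf' : HasFDerivAt f f' (p + (0 : ℝ) • w) := by simpa using hf
    exact hf'.comp_hasDerivAt 0 h2
  have h3 := (hasDerivAt_iff_tendsto_slope.mp h1).eventually (gt_mem_nhds hw)
  have h4 := nhdsWithin_mono (0 : ℝ) (fun t (ht : 0 < t) => ne_of_gt ht) h3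
  filter_upwards [h4, self_mem_nhdsWithin] with t ht ht0
  have ht0 : 0 < t := ht0
  rw [slope_def_field, sub_zero, zero_smul, add_zero, h0, sub_zero] at ht
  by_contra hge
  exact absurd ht (not_lt.mpr (div_nonneg (not_lt.mp hge) ht0.le))

/-- Otherwise the points `p + t • w` with small `t > 0` would be outside `B` according to `ρ` and
inside according to `ρ'`. -/
theorem IsDefiningFunction.fderiv_nonneg (h : IsDefiningFunction B O ρ)
    (h' : IsDefiningFunction B O' ρ') (hB : IsOpen B) (hp : p ∈ O) (hp' : p ∈ O')
    (hpB : p ∈ frontier B) (hw : 0 < fderiv ℝ ρ p w) : 0 ≤ fderiv ℝ ρ' p w := by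
  by_contra hneg
  rw [not_le] at hneg
  have h1 := eventually_neg_along (h'.differentiableAt hp').hasFDerivAt (h'.eq_zero hB hp' hpB) hneg
  have h2 : ∀ᶠ t in 𝓝[>] (0 : ℝ), (fun x => -ρ x) (p + t • w) < 0 := by
    refine eventually_neg_along (h.differentiableAt hp).hasFDerivAt.neg ?_ ?_
    · simp [h.eq_zero hB hp hpB]
    · simpa using hw
  have hlim : Tendsto (fun t : ℝ => p + t • w) (𝓝[>] 0) (𝓝 p) := by
    have : Continuous fun t : ℝ => p + t • w := by fun_prop
    have h3 := this.tendsto 0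
    rw [zero_smul, add_zero] at h3
    exact h3.mono_left nhdsWithin_le_nhds
  obtain ⟨t, h1, h2, h3, h4⟩ := (h1.and (h2.and ((hlim.eventually (h.isOpen.mem_nhds hp)).and
    (hlim.eventually (h'.isOpen.mem_nhds hp'))))).exists
  have h5 := (h.mem_iff h3).mp ((h'.mem_iff h4).mpr h1)
  simp only at h2
  linarith

/-- Whether a vector points outward does not depend on the defining function. -/
theorem IsDefiningFunction.fderiv_pos (h : IsDefiningFunction B O ρ)
    (h' : IsDefiningFunction B O' ρ') (hB : IsOpen B) (hp : p ∈ O) (hp' : p ∈ O')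
    (hpB : p ∈ frontier B) (hw : 0 < fderiv ℝ ρ p w) : 0 < fderiv ℝ ρ' p w := by
  obtain ⟨v, hv⟩ : ∃ v, 0 < fderiv ℝ ρ' p v := by
    obtain ⟨v, hv⟩ := DFunLike.ne_iff.mp (h'.fderiv_ne_zero p hp')
    rcases lt_or_gt_of_ne hv with hlt | hgt
    · exact ⟨-v, by simpa using hlt⟩
    · exact ⟨v, hgt⟩
  -- Strictness comes from openness: tilting `w` slightly against a direction in which `ρ'`
  -- increases keeps it outward for `ρ`, so the weak inequality for the tilted vector is strict for
  -- `w`.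
  obtain ⟨δ, hδ, hδw⟩ : ∃ δ : ℝ, 0 < δ ∧ 0 < fderiv ℝ ρ p (w - δ • v) := by
    have hc : Continuous fun δ : ℝ => fderiv ℝ ρ p (w - δ • v) := by fun_prop
    have h1 : ∀ᶠ δ in 𝓝[>] (0 : ℝ), 0 < fderiv ℝ ρ p (w - δ • v) :=
      (hc.tendsto 0).mono_left nhdsWithin_le_nhds |>.eventually (lt_mem_nhds (by simpa using hw))
    obtain ⟨δ, h2, h3⟩ := (h1.and self_mem_nhdsWithin).exists
    exact ⟨δ, h3, h2⟩
  have h2 := h.fderiv_nonneg h' hB hp hp' hpB hδw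
  rw [map_sub, map_smul, smul_eq_mul] at h2
  nlinarith

end Outward

/-! ### The graph as a boundary chart. -/

section GraphChart

variable {V : Type*} [NormedAddCommGroup V] [NormedSpace ℝ V] {n : ℕ} {B : Set V}
  {A : ((Fin n → ℝ) × ℝ) ≃L[ℝ] V} {Y : Set (Fin n → ℝ)} {I : Set ℝ} {g : (Fin n → ℝ) → ℝ}
  {L : NNReal}

theorem IsSubgraphOn.hasFDerivAt {E : Type*} [NormedAddCommGroup E] [NormedSpace ℝ E]
    {B : Set (E × ℝ)} {Y : Set E} {g : E → ℝ} (hG : IsSubgraphOn B Y I g L) {y : E}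
    (hy : y ∈ Y) : HasFDerivAt g (fderiv ℝ g y) y :=
  ((hG.contDiffOn.contDiffAt (hG.isOpen_base.mem_nhds hy)).differentiableAt
    (by norm_num)).hasFDerivAt

theorem IsSubgraphOn.isOpen_box (hG : IsSubgraphOn (A ⁻¹' B) Y I g L) :
    IsOpen (A.symm ⁻¹' (Y ×ˢ I)) :=
  (hG.isOpen_base.prod hG.isOpen_fiber).preimage A.symm.continuous

theorem IsSubgraphOn.graphMap_mem_box (hG : IsSubgraphOn (A ⁻¹' B) Y I g L) {y : Fin n → ℝ}
    (hy : y ∈ Y) : graphMap A g y ∈ A.symm ⁻¹' (Y ×ˢ I) := by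
  simp [graphMap, hy, hG.mapsTo hy]

theorem IsSubgraphOn.hasFDerivAt_sub (hG : IsSubgraphOn (A ⁻¹' B) Y I g L) {x : V}
    (hx : x ∈ A.symm ⁻¹' (Y ×ˢ I)) :
    HasFDerivAt (fun x => (A.symm x).2 - g (A.symm x).1)
      (graphConormal A (fderiv ℝ g (A.symm x).1)) x := by
  have h1 : HasFDerivAt (fun x => (A.symm x).1) ((ContinuousLinearMap.fst ℝ (Fin n → ℝ) ℝ).comp
      (A.symm : V →L[ℝ] (Fin n → ℝ) × ℝ)) x :=
    ((ContinuousLinearMap.fst ℝ (Fin n → ℝ) ℝ).comp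
      (A.symm : V →L[ℝ] (Fin n → ℝ) × ℝ)).hasFDerivAt
  have h2 : HasFDerivAt (fun x => (A.symm x).2) ((ContinuousLinearMap.snd ℝ (Fin n → ℝ) ℝ).comp
      (A.symm : V →L[ℝ] (Fin n → ℝ) × ℝ)) x :=
    ((ContinuousLinearMap.snd ℝ (Fin n → ℝ) ℝ).comp
      (A.symm : V →L[ℝ] (Fin n → ℝ) × ℝ)).hasFDerivAt
  exact h2.sub ((hG.hasFDerivAt (mem_prod.mp hx).1).comp x h1)

theorem IsSubgraphOn.isDefiningFunction (hG : IsSubgraphOn (A ⁻¹' B) Y I g L) :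
    IsDefiningFunction B (A.symm ⁻¹' (Y ×ˢ I)) fun x => (A.symm x).2 - g (A.symm x).1 where
  isOpen := hG.isOpen_box
  contDiffOn := by
    have h1 : ContDiff ℝ 2 fun x => (A.symm x).1 := contDiff_fst.comp A.symm.contDiff
    have h2 : ContDiff ℝ 2 fun x => (A.symm x).2 := contDiff_snd.comp A.symm.contDiff
    exact h2.contDiffOn.sub (hG.contDiffOn.comp h1.contDiffOn fun x hx => (mem_prod.mp hx).1)
  fderiv_ne_zero x hx h0 := by
    rw [(hG.hasFDerivAt_sub hx).fderiv] at h0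
    have := graphConormal_axis (A := A) (g' := fderiv ℝ g (A.symm x).1)
    rw [h0] at this
    simp at this
  inter_eq := by
    ext x
    rw [inter_comm, mem_inter_iff]
    refine and_congr_right fun hx => ?_
    have := hG.mem_iff _ (mem_prod.mp hx).1 _ (mem_prod.mp hx).2
    rw [sub_neg, ← this]
    simp

theorem IsSubgraphOn.mem_frontier_iff (hG : IsSubgraphOn (A ⁻¹' B) Y I g L) (hB : IsOpen B)
    {x : V} (hx : x ∈ A.symm ⁻¹' (Y ×ˢ I)) :
    x ∈ frontier B ↔ graphMap A g (A.symm x).1 = x := by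
  have hiff : graphMap A g (A.symm x).1 = x ↔ (A.symm x).2 - g (A.symm x).1 = 0 := by
    rw [graphMap, ← A.eq_symm_apply, Prod.ext_iff, sub_eq_zero]
    simp [eq_comm]
  rw [hiff]
  refine ⟨hG.isDefiningFunction.eq_zero hB hx, fun h0 => ?_⟩
  rw [hB.frontier_eq]
  refine ⟨?_, fun hxB => ?_⟩
  -- Moving down the axis from a point of the graph enters `B` at once, so the point lies in the
  -- closure.
  · have h1 := eventually_neg_along (w := -axis A) (hG.hasFDerivAt_sub hx) h0
      (by rw [map_neg, graphConormal_axis]; norm_num)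
    have hlim : Tendsto (fun t : ℝ => x + t • -axis A) (𝓝[>] 0) (𝓝 x) := by
      have : Continuous fun t : ℝ => x + t • -axis A := by fun_prop
      have h3 := this.tendsto 0
      rw [zero_smul, add_zero] at h3
      exact h3.mono_left nhdsWithin_le_nhds
    refine mem_closure_of_tendsto hlim ?_
    filter_upwards [h1, hlim.eventually (hG.isOpen_box.mem_nhds hx)] with t ht htO
    exact (hG.isDefiningFunction.mem_iff htO).mpr ht
  · exact absurd h0 ((hG.isDefiningFunction.mem_iff hx).mp hxB).ne

theorem IsSubgraphOn.graphMap_mem_frontier (hG : IsSubgraphOn (A ⁻¹' B) Y I g L) (hB : IsOpen B)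
    {y : Fin n → ℝ} (hy : y ∈ Y) : graphMap A g y ∈ frontier B :=
  (hG.mem_frontier_iff hB (hG.graphMap_mem_box hy)).mpr (by simp [graphMap])

theorem IsSubgraphOn.isBoundaryChart (hG : IsSubgraphOn (A ⁻¹' B) Y I g L) (hB : IsOpen B)
    {Ω : V [⋀^Fin (n + 1)]→ₗ[ℝ] ℝ} {ε : ℤˣ} (hε : 0 < ((ε : ℤ) : ℝ) * frameVolume Ω A) :
    IsBoundaryChart Ω B Y (graphMap A g) ε where
  isOpen := hG.isOpen_base
  contDiffOn := A.contDiff.comp_contDiffOn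
    (contDiffOn_id.prodMk (hG.contDiffOn.of_le (by norm_num)))
  immersion y hy := by
    rw [(hasFDerivAt_graphMap (hG.hasFDerivAt hy)).fderiv]
    intro u v huv
    have := A.injective huv
    exact (Prod.ext_iff.mp this).1
  injOn y _ z _ hyz := (Prod.ext_iff.mp (A.injective hyz)).1
  mapsTo y hy := hG.graphMap_mem_frontier hB hy
  openMap U' hU' hU'o := by
    refine ⟨A.symm ⁻¹' (U' ×ˢ I), (hU'o.prod hG.isOpen_fiber).preimage A.symm.continuous, ?_⟩
    ext x
    constructor
    · rintro ⟨y, hy, rfl⟩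
      exact ⟨by simp [graphMap, hy, hG.mapsTo (hU' hy)], hG.graphMap_mem_frontier hB (hU' hy)⟩
    · rintro ⟨hx, hxB⟩
      exact ⟨(A.symm x).1, hx.1, (hG.mem_frontier_iff hB ⟨hU' hx.1, hx.2⟩).mp hxB⟩
  orientation y hy w := by
    rintro ⟨O, ρ, hyO, hρ, hw⟩
    have hbox := hG.graphMap_mem_box hy
    have h1 := hρ.fderiv_pos hG.isDefiningFunction hB hyO hbox (hG.graphMap_mem_frontier hB hy) hw
    rw [(hG.hasFDerivAt_sub hbox).fderiv] at h1
    have h2 : (A.symm (graphMap A g y)).1 = y := by simp [graphMap]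
    rw [h2] at h1
    rw [map_vecCons_partialDeriv_graphMap (hG.hasFDerivAt hy)]
    calc 0 < graphConormal A (fderiv ℝ g y) w * (((ε : ℤ) : ℝ) * frameVolume Ω A) := mul_pos h1 hε
      _ = _ := by ring

end GraphChart

/-! ### The boundary measure inside a graph box. -/

section BoundaryMeasure

theorem measurableSet_inter_preimage_of_continuousOn {X Z : Type*} [TopologicalSpace X]
    [MeasurableSpace X] [BorelSpace X] [TopologicalSpace Z] [MeasurableSpace Z] [BorelSpace Z]
    {f : X → Z} {u : Set X} (hf : ContinuousOn f u) (hu : MeasurableSet u) {s : Set Z}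
    (hs : MeasurableSet s) : MeasurableSet (u ∩ f ⁻¹' s) := by
  have h := hu.subtype_image ((continuousOn_iff_continuous_domRestrict.mp hf).measurable hs)
  have heq : Subtype.val '' (u.domRestrict f ⁻¹' s) = u ∩ f ⁻¹' s :=
    Subtype.image_preimage_coe u (f ⁻¹' s)
  rwa [heq] at h

variable {V : Type*} [NormedAddCommGroup V] [NormedSpace ℝ V] {n : ℕ} {B : Set V}
  {A : ((Fin n → ℝ) × ℝ) ≃L[ℝ] V} {Y : Set (Fin n → ℝ)} {I : Set ℝ} {g : (Fin n → ℝ) → ℝ}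
  {L : NNReal} {Ω : V [⋀^Fin (n + 1)]→ₗ[ℝ] ℝ} {U : Set (Fin n → ℝ)} {α : (Fin n → ℝ) → V} {ε : ℤˣ}

theorem chartMeasure_apply [MeasurableSpace V] [BorelSpace V] (F : ⋀[ℝ]^n V → ℝ) (hU : IsOpen U)
    (hα : ContinuousOn α U) {s : Set V} (hs : MeasurableSet s) :
    chartMeasure F U α ε s = ∫⁻ x in U ∩ α ⁻¹' s,
      ENNReal.ofReal (F (((ε : ℤ) : ℝ) • exteriorPower.ιMulti ℝ n (partialDeriv α x))) := by
  have hm : AEMeasurable α (volume.restrict U) := hα.aemeasurable hU.measurableSet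
  rw [chartMeasure, Measure.map_apply_of_aemeasurable
    (hm.mono_ac (withDensity_absolutelyContinuous _ _)) hs, withDensity_apply',
    Measure.restrict_restrict' hU.measurableSet, inter_comm]

theorem IsSubgraphOn.continuousOn_graphMap (hG : IsSubgraphOn (A ⁻¹' B) Y I g L) :
    ContinuousOn (graphMap A g) Y :=
  A.continuous.comp_continuousOn (continuousOn_id.prodMk hG.contDiffOn.continuousOn)

/-- Near `x` the chart factors as the graph map after its own base projection, because its values
lie on the boundary. Here `D` is the derivative of this transition map. -/
theorem IsSubgraphOn.hasFDerivAt_base (hG : IsSubgraphOn (A ⁻¹' B) Y I g L) (hB : IsOpen B)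
    (hα : IsBoundaryChart Ω B U α ε) {x : Fin n → ℝ} (hx : x ∈ U)
    (hxb : α x ∈ A.symm ⁻¹' (Y ×ˢ I)) :
    ∃ D : (Fin n → ℝ) →L[ℝ] (Fin n → ℝ), HasFDerivAt (fun z => (A.symm (α z)).1) D x ∧
      ∀ η, Ω (Matrix.vecCons η (partialDeriv α x)) =
        D.det * (graphConormal A (fderiv ℝ g (A.symm (α x)).1) η * frameVolume Ω A) := by
  have hαd : HasFDerivAt α (fderiv ℝ α x) x :=
    ((hα.contDiffOn.contDiffAt (hα.isOpen.mem_nhds hx)).differentiableAt (by norm_num)).hasFDerivAt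
  set y := (A.symm (α x)).1 with hy
  have hyY : y ∈ Y := (mem_prod.mp hxb).1
  have hD : HasFDerivAt (fun z => (A.symm (α z)).1)
      (((ContinuousLinearMap.fst ℝ (Fin n → ℝ) ℝ).comp (A.symm : V →L[ℝ] (Fin n → ℝ) × ℝ)).comp
        (fderiv ℝ α x)) x :=
    (((ContinuousLinearMap.fst ℝ (Fin n → ℝ) ℝ).comp
      (A.symm : V →L[ℝ] (Fin n → ℝ) × ℝ)).hasFDerivAt).comp x hαd
  refine ⟨_, hD, fun η => ?_⟩
  have hψ := hasFDerivAt_graphMap (A := A) (hG.hasFDerivAt hyY)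
  have hcomp := hψ.comp x hD
  have heq : (graphMap A g ∘ fun z => (A.symm (α z)).1) =ᶠ[𝓝 x] α := by
    filter_upwards [hα.isOpen.mem_nhds hx,
      hαd.continuousAt.preimage_mem_nhds (hG.isOpen_box.mem_nhds hxb)] with z hz hzb
    exact (hG.mem_frontier_iff hB hzb).mp (hα.mapsTo hz)
  have hfd := (hcomp.congr_of_eventuallyEq heq.symm).fderiv
  have h1 : partialDeriv α x = fun i => (fderiv ℝ (graphMap A g) y)
      ((((ContinuousLinearMap.fst ℝ (Fin n → ℝ) ℝ).comp (A.symm : V →L[ℝ] (Fin n → ℝ) × ℝ)).comp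
        (fderiv ℝ α x)) (Pi.single i 1)) := by
    funext i
    rw [hψ.fderiv]
    conv_lhs => rw [partialDeriv, hfd]
    rfl
  rw [h1, map_vecCons_comp, ← map_vecCons_partialDeriv_graphMap (hG.hasFDerivAt hyY)]
  rfl

variable [Fact (Module.finrank ℝ V = n + 1)] {hΩ : Ω ≠ 0} {F : ⋀[ℝ]^n V → ℝ}

/-- The anisotropic area density of a graph, in the linear coordinates `A`. -/
noncomputable def graphDensity (Ω : V [⋀^Fin (n + 1)]→ₗ[ℝ] ℝ) (hΩ : Ω ≠ 0) (F : ⋀[ℝ]^n V → ℝ)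
    (A : ((Fin n → ℝ) × ℝ) ≃L[ℝ] V) (g : (Fin n → ℝ) → ℝ) (y : Fin n → ℝ) : ℝ :=
  |frameVolume Ω A| * dualFunctional Ω hΩ F (graphConormal A (fderiv ℝ g y) : V →ₗ[ℝ] ℝ)

theorem graphDensity_nonneg (hF : IsConvexDensity F) (y : Fin n → ℝ) :
    0 ≤ graphDensity Ω hΩ F A g y :=
  mul_nonneg (abs_nonneg _) (hF.dualFunctional_nonneg _)

/-- Testing the orientation condition on `axis A` shows that `ε * det D * frameVolume` is positive,
hence equal to the product of absolute values. It can then be pulled out of `F` by positive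
homogeneity alone. -/
theorem IsSubgraphOn.density_eq (hG : IsSubgraphOn (A ⁻¹' B) Y I g L) (hB : IsOpen B)
    (hF : IsConvexDensity F)
    (hα : IsBoundaryChart Ω B U α ε) {x : Fin n → ℝ} (hx : x ∈ U)
    (hxb : α x ∈ A.symm ⁻¹' (Y ×ˢ I)) :
    F (((ε : ℤ) : ℝ) • exteriorPower.ιMulti ℝ n (partialDeriv α x)) =
      |(fderiv ℝ (fun z => (A.symm (α z)).1) x).det| *
        graphDensity Ω hΩ F A g (A.symm (α x)).1 := by
  obtain ⟨D, hD, hΩα⟩ := hG.hasFDerivAt_base hB hα hx hxb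
  rw [hD.fderiv]
  have hpos : 0 < ((ε : ℤ) : ℝ) * (D.det * frameVolume Ω A) := by
    have h1 := hα.orientation x hx (axis A)
      ⟨_, _, hxb, hG.isDefiningFunction, by
        rw [(hG.hasFDerivAt_sub hxb).fderiv, graphConormal_axis]; exact one_pos⟩
    rwa [hΩα, graphConormal_axis, one_mul] at h1
  have habs : ((ε : ℤ) : ℝ) * (D.det * frameVolume Ω A) = |D.det| * |frameVolume Ω A| := by
    rw [← abs_of_pos hpos, abs_mul, abs_mul]
    rcases Int.units_eq_one_or ε with rfl | rfl <;> simp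
  have hh : hodge Ω (((ε : ℤ) : ℝ) • exteriorPower.ιMulti ℝ n (partialDeriv α x)) =
      (|D.det| * |frameVolume Ω A|) •
        (graphConormal A (fderiv ℝ g (A.symm (α x)).1) : V →ₗ[ℝ] ℝ) := by
    ext η
    rw [map_smul, LinearMap.smul_apply, hodge_ιMulti, hΩα, ← habs, LinearMap.smul_apply]
    simp only [smul_eq_mul, ContinuousLinearMap.coe_coe]
    ring
  rw [← dualFunctional_hodge (hΩ := hΩ) (F := F), hh, hF.dualFunctional_smul (by positivity),
    graphDensity, mul_assoc]

variable [MeasurableSpace V] [BorelSpace V]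

/-- The Jacobian in the density is that of the base projection, which is injective on the relevant
set; this is the change of variables formula. -/
theorem IsSubgraphOn.chartMeasure_eq_lintegral_image (hG : IsSubgraphOn (A ⁻¹' B) Y I g L)
    (hB : IsOpen B) (hF : IsConvexDensity F)
    (hα : IsBoundaryChart Ω B U α ε) {s : Set V} (hs : MeasurableSet s)
    (hsb : s ⊆ A.symm ⁻¹' (Y ×ˢ I)) :
    chartMeasure F U α ε s = ∫⁻ y in (fun z => (A.symm (α z)).1) '' (U ∩ α ⁻¹' s),
      ENNReal.ofReal (graphDensity Ω hΩ F A g y) := by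
  have hm : MeasurableSet (U ∩ α ⁻¹' s) :=
    measurableSet_inter_preimage_of_continuousOn hα.contDiffOn.continuousOn
      hα.isOpen.measurableSet hs
  have hinj : InjOn (fun z => (A.symm (α z)).1) (U ∩ α ⁻¹' s) := by
    intro x hx z hz hxz
    refine hα.injOn hx.1 hz.1 ?_
    rw [← (hG.mem_frontier_iff hB (hsb hx.2)).mp (hα.mapsTo hx.1),
      ← (hG.mem_frontier_iff hB (hsb hz.2)).mp (hα.mapsTo hz.1)]
    exact congrArg (graphMap A g) hxz
  rw [lintegral_image_eq_lintegral_abs_det_fderiv_mul volume hm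
    (f' := fderiv ℝ fun z => (A.symm (α z)).1) (fun x hx => ?_) hinj,
    chartMeasure_apply F hα.isOpen hα.contDiffOn.continuousOn hs]
  · refine setLIntegral_congr_fun hm fun x hx => ?_
    rw [hG.density_eq (hΩ := hΩ) hB hF hα hx.1 (hsb hx.2), ENNReal.ofReal_mul (abs_nonneg _)]
  · obtain ⟨D, hD, -⟩ := hG.hasFDerivAt_base hB hα hx.1 (hsb hx.2)
    exact hD.differentiableAt.hasFDerivAt.hasFDerivWithinAt

/-- The area measure of the part of the boundary that is a graph. -/
noncomputable def graphMeasure (Ω : V [⋀^Fin (n + 1)]→ₗ[ℝ] ℝ) (hΩ : Ω ≠ 0) (F : ⋀[ℝ]^n V → ℝ)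
    (A : ((Fin n → ℝ) × ℝ) ≃L[ℝ] V) (g : (Fin n → ℝ) → ℝ) (Y : Set (Fin n → ℝ)) : Measure V :=
  ((volume.restrict Y).withDensity fun y => ENNReal.ofReal (graphDensity Ω hΩ F A g y)).map
    (graphMap A g)

theorem IsSubgraphOn.aemeasurable_graphMap (hG : IsSubgraphOn (A ⁻¹' B) Y I g L) :
    AEMeasurable (graphMap A g) ((volume.restrict Y).withDensity fun y =>
      ENNReal.ofReal (graphDensity Ω hΩ F A g y)) :=
  (hG.continuousOn_graphMap.aemeasurable hG.isOpen_base.measurableSet).mono_ac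
    (withDensity_absolutelyContinuous _ _)

theorem IsSubgraphOn.graphMeasure_apply (hG : IsSubgraphOn (A ⁻¹' B) Y I g L) {s : Set V}
    (hs : MeasurableSet s) : graphMeasure Ω hΩ F A g Y s =
      ∫⁻ y in Y ∩ graphMap A g ⁻¹' s, ENNReal.ofReal (graphDensity Ω hΩ F A g y) := by
  rw [graphMeasure, Measure.map_apply_of_aemeasurable hG.aemeasurable_graphMap hs,
    withDensity_apply', Measure.restrict_restrict' hG.isOpen_base.measurableSet, inter_comm]

theorem IsSubgraphOn.chartMeasure_le_graphMeasure (hG : IsSubgraphOn (A ⁻¹' B) Y I g L)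
    (hB : IsOpen B) (hF : IsConvexDensity F)
    (hα : IsBoundaryChart Ω B U α ε) {s : Set V} (hs : MeasurableSet s)
    (hsb : s ⊆ A.symm ⁻¹' (Y ×ˢ I)) :
    chartMeasure F U α ε s ≤ graphMeasure Ω hΩ F A g Y s := by
  rw [hG.chartMeasure_eq_lintegral_image (hΩ := hΩ) hB hF hα hs hsb, hG.graphMeasure_apply hs]
  refine lintegral_mono_set ?_
  rintro _ ⟨x, ⟨hxU, hxs⟩, rfl⟩
  refine ⟨(mem_prod.mp (hsb hxs)).1, ?_⟩
  rw [mem_preimage, (hG.mem_frontier_iff hB (hsb hxs)).mp (hα.mapsTo hxU)]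
  exact hxs

theorem IsSubgraphOn.graphMeasure_compl (hG : IsSubgraphOn (A ⁻¹' B) Y I g L) {s : Set V}
    (hs : MeasurableSet s) (hYs : MapsTo (graphMap A g) Y s) :
    graphMeasure Ω hΩ F A g Y sᶜ = 0 := by
  rw [hG.graphMeasure_apply hs.compl]
  have : Y ∩ graphMap A g ⁻¹' sᶜ = ∅ := by
    ext y
    simp only [mem_inter_iff, mem_preimage, mem_compl_iff, mem_empty_iff_false, iff_false, not_and,
      not_not]
    exact fun hy => hYs hy
  rw [this, setLIntegral_empty]

theorem IsSubgraphOn.graphMeasure_le_boundaryMeasure (hG : IsSubgraphOn (A ⁻¹' B) Y I g L)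
    (hB : IsOpen B) (hF : IsConvexDensity F) (hA : frameVolume Ω A ≠ 0) :
    graphMeasure Ω hΩ F A g Y ≤ boundaryMeasure Ω F B := by
  obtain ⟨ε, hε⟩ : ∃ ε : ℤˣ, 0 < ((ε : ℤ) : ℝ) * frameVolume Ω A := by
    rcases lt_or_gt_of_ne hA with hlt | hgt
    · exact ⟨-1, by simpa using hlt⟩
    · exact ⟨1, by simpa using hgt⟩
  have hchart := hG.isBoundaryChart hB hε
  have hle : graphMeasure Ω hΩ F A g Y ≤ chartMeasure F Y (graphMap A g) ε := by
    rw [Measure.le_iff]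
    intro s hs
    set b := A.symm ⁻¹' (Y ×ˢ I) with hb
    have hbm : MeasurableSet b := hG.isOpen_box.measurableSet
    calc graphMeasure Ω hΩ F A g Y s
        = graphMeasure Ω hΩ F A g Y (s ∩ b) := by
          refine (measure_inter_conull' ?_).symm
          exact measure_mono_null (fun x hx => hx.2)
            (hG.graphMeasure_compl hbm fun y hy => hG.graphMap_mem_box hy)
      -- For the graph chart the transition map is the identity.
      _ = chartMeasure F Y (graphMap A g) ε (s ∩ b) := by
          rw [hG.chartMeasure_eq_lintegral_image (hΩ := hΩ) hB hF hchart (hs.inter hbm)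
            inter_subset_right, hG.graphMeasure_apply (hs.inter hbm)]
          simp [graphMap]
      _ ≤ _ := measure_mono inter_subset_left
  refine hle.trans ?_
  exact le_iSup_of_le Y (le_iSup_of_le (graphMap A g) (le_iSup_of_le ε
    (le_iSup_of_le hchart le_rfl)))

/-- Inside the box, the boundary measure is the area measure of the graph. -/
theorem IsSubgraphOn.boundaryMeasure_restrict (hG : IsSubgraphOn (A ⁻¹' B) Y I g L)
    (hB : IsOpen B) (hF : IsConvexDensity F) (hA : frameVolume Ω A ≠ 0) :
    (boundaryMeasure Ω F B).restrict (A.symm ⁻¹' (Y ×ˢ I)) = graphMeasure Ω hΩ F A g Y := by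
  set b := A.symm ⁻¹' (Y ×ˢ I) with hb
  have hbm : MeasurableSet b := hG.isOpen_box.measurableSet
  have hres : (graphMeasure Ω hΩ F A g Y).restrict b = graphMeasure Ω hΩ F A g Y :=
    Measure.restrict_eq_self_of_ae_mem (by
      rw [ae_iff]
      exact hG.graphMeasure_compl hbm fun y hy => hG.graphMap_mem_box hy)
  refine le_antisymm ?_ ?_
  -- Outside the box the boundary measure itself serves as the bound. The right side therefore
  -- dominates every chart measure and hence their supremum, with no formula for a supremum of
  -- measures.
  · have hle : boundaryMeasure Ω F B ≤
        (boundaryMeasure Ω F B).restrict bᶜ + graphMeasure Ω hΩ F A g Y := by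
      refine iSup_le fun U => iSup_le fun α => iSup_le fun ε => iSup_le fun hα => ?_
      rw [Measure.le_iff]
      intro s hs
      rw [← measure_inter_add_sdiff s hbm, Measure.add_apply, Measure.restrict_apply hs, add_comm]
      refine add_le_add ?_ ?_
      · have h1 : chartMeasure F U α ε ≤ boundaryMeasure Ω F B :=
          le_iSup_of_le U (le_iSup_of_le α (le_iSup_of_le ε (le_iSup_of_le hα le_rfl)))
        exact h1 _
      · exact (hG.chartMeasure_le_graphMeasure (hΩ := hΩ) hB hF hα (hs.inter hbm)
          inter_subset_right).trans (measure_mono inter_subset_left)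
    calc (boundaryMeasure Ω F B).restrict b
        ≤ ((boundaryMeasure Ω F B).restrict bᶜ + graphMeasure Ω hΩ F A g Y).restrict b :=
          Measure.restrict_mono le_rfl hle
      _ = graphMeasure Ω hΩ F A g Y := by
          rw [Measure.restrict_add, Measure.restrict_restrict hbm, inter_compl_self,
            Measure.restrict_empty, zero_add, hres]
  · rw [← hres]
    exact Measure.restrict_mono le_rfl (hG.graphMeasure_le_boundaryMeasure hB hF hA)

end BoundaryMeasure

/-! ### `C²` boundaries as local graphs. -/

section LocalGraph

variable {V : Type*} [NormedAddCommGroup V] [NormedSpace ℝ V] {n : ℕ}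

theorem exists_coordinates [FiniteDimensional ℝ V] (hV : Module.finrank ℝ V = n + 1)
    {f : V →L[ℝ] ℝ} (hf : f ≠ 0) :
    ∃ A : ((Fin n → ℝ) × ℝ) ≃L[ℝ] V, f (axis A) = 1 := by
  obtain ⟨v, hv⟩ := DFunLike.ne_iff.mp hf
  rw [zero_apply] at hv
  have hfr : Module.finrank ℝ ((Fin n → ℝ) × ℝ) = Module.finrank ℝ V := by
    rw [hV]; simp
  let A₀ : ((Fin n → ℝ) × ℝ) ≃L[ℝ] V := ContinuousLinearEquiv.ofFinrankEq hfr
  have h1 : A₀ (0, 1) ≠ 0 := by simp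
  have h2 : (f v)⁻¹ • v ≠ 0 := by
    intro h0
    have := congrArg f h0
    simp [hv] at this
  obtain ⟨C, hC⟩ := SeparatingDual.exists_continuousLinearEquiv_apply_eq (R := ℝ) h1 h2
  exact ⟨A₀.trans C, by simp [axis, hC, hv]⟩

theorem strictMonoOn_fiber {E : Type*} [NormedAddCommGroup E] [NormedSpace ℝ E] {f : E × ℝ → ℝ}
    {y : E} {I : Set ℝ} (hI : Convex ℝ I) (hd : ∀ s ∈ I, DifferentiableAt ℝ f (y, s))
    (hpos : ∀ s ∈ I, 0 < fderiv ℝ f (y, s) (0, 1)) : StrictMonoOn (fun s => f (y, s)) I := by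
  have hder : ∀ s ∈ I, HasDerivAt (fun s => f (y, s)) (fderiv ℝ f (y, s) (0, 1)) s := fun s hs =>
    (hd s hs).hasFDerivAt.comp_hasDerivAt s ((hasDerivAt_const s y).prodMk (hasDerivAt_id s))
  refine strictMonoOn_of_deriv_pos hI
    (fun s hs => (hder s hs).continuousAt.continuousWithinAt) fun s hs => ?_
  rw [(hder s (interior_subset hs)).deriv]
  exact hpos s (interior_subset hs)

/-- A domain with `C²` boundary is locally a subgraph. -/
theorem HasC2Boundary.exists_isSubgraphOn [FiniteDimensional ℝ V]
    (hV : Module.finrank ℝ V = n + 1) {B : Set V} (hB : IsOpen B) (hC2 : HasC2Boundary B) {p : V}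
    (hp : p ∈ frontier B) :
    ∃ (A : ((Fin n → ℝ) × ℝ) ≃L[ℝ] V) (Y : Set (Fin n → ℝ)) (I : Set ℝ) (g : (Fin n → ℝ) → ℝ)
      (L : NNReal), IsSubgraphOn (A ⁻¹' B) Y I g L ∧ p ∈ A.symm ⁻¹' (Y ×ˢ I) := by
  obtain ⟨O, ρ, hpO, hρ⟩ := hC2 p hp
  obtain ⟨A, hA⟩ := exists_coordinates hV (hρ.fderiv_ne_zero p hpO)
  set f : (Fin n → ℝ) × ℝ → ℝ := fun x => ρ (A x) with hf
  set u := A.symm p with hu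
  have hAu : A u = p := by simp [hu]
  have hfu : f u = 0 := by rw [hf]; simp only; rw [hAu, hρ.eq_zero hB hpO hp]
  have hρp : ContDiffAt ℝ 2 ρ (A u) := by
    rw [hAu]; exact hρ.contDiffOn.contDiffAt (hρ.isOpen.mem_nhds hpO)
  have cdf : ContDiffAt ℝ 2 f u := hρp.comp u A.contDiff.contDiffAt
  have hdu : fderiv ℝ f u (0, 1) = 1 := by
    have h1 : HasFDerivAt f ((fderiv ℝ ρ (A u)).comp (A : (Fin n → ℝ) × ℝ →L[ℝ] V)) u :=
      (hρp.differentiableAt (by norm_num)).hasFDerivAt.comp u A.hasFDerivAt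
    rw [h1.fderiv, hAu]
    exact hA
  have hinv : (fderiv ℝ f u ∘L .inr ℝ (Fin n → ℝ) ℝ).IsInvertible := by
    refine ⟨ContinuousLinearEquiv.refl ℝ ℝ, ?_⟩
    ext
    simp [hdu]
  have htwo : (2 : WithTop ℕ∞) ≠ 0 := by norm_num
  -- The axis was chosen so that the derivative of `f` in the last variable is `1` at `u`, so the
  -- zero set near `u` is a graph over the base.
  set ψ := cdf.implicitFunction htwo hinv
  have hψu : ψ u.1 = u.2 := cdf.implicitFunction_apply_self htwo hinv
  have hψc : ContDiffAt ℝ 2 ψ u.1 := cdf.contDiffAt_implicitFunction htwo hinv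
  obtain ⟨L, T, hT, hL⟩ := (hψc.of_le (by norm_num) : ContDiffAt ℝ 1 ψ u.1).exists_lipschitzOnWith
  have hfc : ContinuousAt (fun x => fderiv ℝ f x (0, 1)) u :=
    (cdf.fderiv_right (m := 1) (by norm_num)).continuousAt.clm_apply continuousAt_const
  have hN : ∀ᶠ x in 𝓝 u, A x ∈ O ∧ DifferentiableAt ℝ f x ∧ 0 < fderiv ℝ f x (0, 1) := by
    refine (A.continuous.continuousAt.eventually ?_).and (Eventually.and ?_ ?_)
    · rw [hAu]; exact hρ.isOpen.mem_nhds hpO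
    · filter_upwards [cdf.eventually (by simp)] with x hx using hx.differentiableAt (by norm_num)
    · exact hfc.eventually (lt_mem_nhds (show 0 < fderiv ℝ f u (0, 1) by rw [hdu]; exact one_pos))
  obtain ⟨r, hr, hball⟩ := Metric.eventually_nhds_iff_ball.mp hN
  have hM : ∀ᶠ y in 𝓝 u.1, y ∈ T ∧ y ∈ Metric.ball u.1 r ∧ ψ y ∈ Metric.ball u.2 r ∧
      f (y, ψ y) = 0 ∧ ContDiffAt ℝ 2 ψ y := by
    have h1 : ∀ᶠ y in 𝓝 u.1, ψ y ∈ Metric.ball u.2 r :=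
      hψc.continuousAt.eventually (hψu ▸ Metric.ball_mem_nhds _ hr)
    have h2 : ∀ᶠ y in 𝓝 u.1, f (y, ψ y) = f u := cdf.eventually_apply_implicitFunction htwo hinv
    filter_upwards [hT, Metric.ball_mem_nhds _ hr, h1, h2, hψc.eventually (by simp)]
      with y hyT hyr hy1 hy2 hyc
    exact ⟨hyT, hyr, hy1, hy2.trans hfu, hyc⟩
  obtain ⟨δ, hδ, hY⟩ := Metric.eventually_nhds_iff_ball.mp hM
  have hbox : ∀ y ∈ Metric.ball u.1 δ, ∀ s ∈ Metric.ball u.2 r, (y, s) ∈ Metric.ball u r := by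
    intro y hy s hs
    rw [← ball_prod_same]
    exact ⟨(hY y hy).2.1, hs⟩
  refine ⟨A, Metric.ball u.1 δ, Metric.ball u.2 r, ψ, L, ?_, ?_, ?_⟩
  · refine ⟨Metric.isOpen_ball, Metric.isBounded_ball, Metric.isOpen_ball,
      fun y hy => (hY y hy).2.2.1, fun y hy => (hY y hy).2.2.2.2.contDiffWithinAt,
      hL.mono fun y hy => (hY y hy).1, fun y hy s hs => ?_⟩
    -- As `f` increases strictly along each fibre and vanishes at `ψ y`, its sign is decided by
    -- comparing `s` with `ψ y`.
    have hmono := strictMonoOn_fiber (f := f) (y := y) (convex_ball u.2 r)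
      (fun s hs => (hball _ (hbox y hy s hs)).2.1) (fun s hs => (hball _ (hbox y hy s hs)).2.2)
    rw [← hmono.lt_iff_lt hs (hY y hy).2.2.1]
    rw [(hY y hy).2.2.2.1, mem_preimage, hρ.mem_iff (hball _ (hbox y hy s hs)).1]
  · exact Metric.mem_ball_self hδ
  · exact Metric.mem_ball_self hr

end LocalGraph

/-! ### Finiteness and the localized limit in one box. -/

section LocalLimit

variable {V : Type*} [NormedAddCommGroup V] [NormedSpace ℝ V] [FiniteDimensional ℝ V] {n : ℕ}
  {B : Set V} {A : ((Fin n → ℝ) × ℝ) ≃L[ℝ] V} {Y : Set (Fin n → ℝ)} {I : Set ℝ}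
  {g : (Fin n → ℝ) → ℝ} {L : NNReal} {Ω : V [⋀^Fin (n + 1)]→ₗ[ℝ] ℝ}
  [Fact (Module.finrank ℝ V = n + 1)] {hΩ : Ω ≠ 0} {F : ⋀[ℝ]^n V → ℝ}

/-- A zero factor would make the measure `|Ω|` vanish on all parallelepipeds, and hence `Ω` vanish.
-/
theorem frameVolume_ne_zero (hΩ : Ω ≠ 0) (A : ((Fin n → ℝ) × ℝ) ≃L[ℝ] V) :
    frameVolume Ω A ≠ 0 := by
  borelize V
  intro h0
  refine hΩ (AlternatingMap.ext fun v => ?_)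
  have h1 := Ω.measure_parallelepiped v
  rw [measure_eq_smul_map Ω A, h0] at h1
  simpa using h1.symm

theorem IsSubgraphOn.continuousOn_graphDensity (hG : IsSubgraphOn (A ⁻¹' B) Y I g L)
    (hF : IsConvexDensity F) : ContinuousOn (graphDensity Ω hΩ F A g) Y := by
  have h1 : ContinuousOn (fderiv ℝ g) Y :=
    hG.contDiffOn.continuousOn_fderiv_of_isOpen hG.isOpen_base (by norm_num)
  have h2 : ContinuousOn (fun y => graphConormal A (fderiv ℝ g y)) Y := by
    unfold graphConormal
    exact ((continuousOn_const.sub (h1.clm_comp continuousOn_const))).clm_comp continuousOn_const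
  exact continuousOn_const.mul ((hF.continuous_dualFunctional (hΩ := hΩ)).comp_continuousOn h2)

/-- The Lipschitz constant bounds the slope, hence the conormal, uniformly on `Y`; with `Y` bounded
this makes the area in a box finite. -/
theorem IsSubgraphOn.exists_graphDensity_le (hG : IsSubgraphOn (A ⁻¹' B) Y I g L)
    (hF : IsConvexDensity F) : ∃ M, ∀ y ∈ Y, graphDensity Ω hΩ F A g y ≤ M := by
  obtain ⟨c, C, hc, hb⟩ := hF.exists_dualFunctional_bounds (hΩ := hΩ)
  set P := ContinuousLinearMap.snd ℝ (Fin n → ℝ) ℝ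
  set Q := ContinuousLinearMap.fst ℝ (Fin n → ℝ) ℝ
  set S := (A.symm : V →L[ℝ] (Fin n → ℝ) × ℝ)
  refine ⟨|frameVolume Ω A| * (|C| * ((‖P‖ + L * ‖Q‖) * ‖S‖)), fun y hy => ?_⟩
  have hL : ‖fderiv ℝ g y‖ ≤ L :=
    norm_fderiv_le_of_lipschitzOn ℝ (hG.isOpen_base.mem_nhds hy) hG.lipschitzOnWith
  refine mul_le_mul_of_nonneg_left ((hb _).2.trans ?_) (abs_nonneg _)
  refine mul_le_mul (le_abs_self C) ?_ (norm_nonneg _) (abs_nonneg _)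
  calc ‖graphConormal A (fderiv ℝ g y)‖ ≤ ‖P - (fderiv ℝ g y).comp Q‖ * ‖S‖ :=
        ContinuousLinearMap.opNorm_comp_le _ _
    _ ≤ (‖P‖ + ‖fderiv ℝ g y‖ * ‖Q‖) * ‖S‖ := by
        gcongr
        exact (norm_sub_le _ _).trans (by gcongr; exact ContinuousLinearMap.opNorm_comp_le _ _)
    _ ≤ _ := by gcongr

variable [MeasurableSpace V] [BorelSpace V]

theorem IsSubgraphOn.boundaryMeasure_box_lt_top (hG : IsSubgraphOn (A ⁻¹' B) Y I g L)
    (hΩ : Ω ≠ 0) (hB : IsOpen B) (hF : IsConvexDensity F) :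
    boundaryMeasure Ω F B (A.symm ⁻¹' (Y ×ˢ I)) < ∞ := by
  obtain ⟨M, hM⟩ := hG.exists_graphDensity_le (hΩ := hΩ) hF
  rw [← Measure.restrict_apply_univ,
    hG.boundaryMeasure_restrict (hΩ := hΩ) hB hF (frameVolume_ne_zero hΩ A),
    hG.graphMeasure_apply MeasurableSet.univ, preimage_univ, inter_univ]
  calc ∫⁻ y in Y, ENNReal.ofReal (graphDensity Ω hΩ F A g y)
      ≤ ∫⁻ _ in Y, ENNReal.ofReal M :=
        setLIntegral_mono measurable_const fun y hy => ENNReal.ofReal_le_ofReal (hM y hy)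
    _ < ∞ := by
        rw [setLIntegral_const]
        exact ENNReal.mul_lt_top ENNReal.ofReal_lt_top hG.isBounded_base.measure_lt_top

theorem IsSubgraphOn.integral_boundaryMeasure (hG : IsSubgraphOn (A ⁻¹' B) Y I g L)
    (hB : IsOpen B) (hF : IsConvexDensity F) {φ : V → ℝ} (hφ : Continuous φ)
    (hφs : tsupport φ ⊆ A.symm ⁻¹' (Y ×ˢ I)) :
    ∫ x in frontier B, φ x ∂boundaryMeasure Ω F B =
      ∫ y in Y, φ (graphMap A g y) * graphDensity Ω hΩ F A g y := by
  set b := A.symm ⁻¹' (Y ×ˢ I) with hb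
  have hbm : MeasurableSet b := hG.isOpen_box.measurableSet
  have h1 : ∫ x in frontier B, φ x ∂boundaryMeasure Ω F B =
      ∫ x in frontier B ∩ b, φ x ∂boundaryMeasure Ω F B := by
    refine setIntegral_eq_of_subset_of_forall_sdiff_eq_zero isClosed_frontier.measurableSet
      inter_subset_left fun x hx => image_eq_zero_of_notMem_tsupport fun hxs => ?_
    exact hx.2 ⟨hx.1, hφs hxs⟩
  have h2 : (graphMeasure Ω hΩ F A g Y).restrict (frontier B) = graphMeasure Ω hΩ F A g Y :=
    Measure.restrict_eq_self_of_ae_mem (by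
      rw [ae_iff]
      exact hG.graphMeasure_compl isClosed_frontier.measurableSet
        fun y hy => hG.graphMap_mem_frontier hB hy)
  have hdm : AEMeasurable (fun y => ENNReal.ofReal (graphDensity Ω hΩ F A g y))
      (volume.restrict Y) :=
    ((hG.continuousOn_graphDensity hF).aemeasurable hG.isOpen_base.measurableSet).ennreal_ofReal
  rw [h1, ← Measure.restrict_restrict isClosed_frontier.measurableSet,
    hG.boundaryMeasure_restrict (hΩ := hΩ) hB hF (frameVolume_ne_zero hΩ A), h2, graphMeasure,
    integral_map hG.aemeasurable_graphMap hφ.aestronglyMeasurable,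
    integral_withDensity_eq_integral_toReal_smul₀ hdm (by simp)]
  refine integral_congr_ae (Eventually.of_forall fun y => ?_)
  simp only
  rw [ENNReal.toReal_ofReal (graphDensity_nonneg hF y), smul_eq_mul, mul_comm]

/-- Transport by `A` multiplies volume by `|frameVolume Ω A|`, which is exactly the constant in
`graphDensity`; the remaining factor on both sides is the support function of the Wulff shape at the
conormal. -/
theorem IsSubgraphOn.tendsto_localized_content (hG : IsSubgraphOn (A ⁻¹' B) Y I g L)
    (hB : IsOpen B) (hF : IsConvexDensity F) {φ : V → ℝ} (hφ : Continuous φ)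
    (hφc : HasCompactSupport φ) (hφs : tsupport φ ⊆ A.symm ⁻¹' (Y ×ˢ I)) :
    Tendsto (fun t : ℝ => t⁻¹ * ∫ x in (B + t • wulffShape Ω hΩ F) \ B, φ x ∂Ω.measure) (𝓝[>] 0)
      (𝓝 (∫ x in frontier B, φ x ∂boundaryMeasure Ω F B)) := by
  rw [hG.integral_boundaryMeasure (hΩ := hΩ) hB hF hφ hφs]
  set W := wulffShape Ω hΩ F with hW
  obtain ⟨R, hR⟩ := hF.exists_norm_le_of_mem_wulffShape (hΩ := hΩ)
  have hpre : ∀ t : ℝ, A ⁻¹' ((B + t • W) \ B) = (A ⁻¹' B + t • (A ⁻¹' W)) \ (A ⁻¹' B) := by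
    intro t
    ext x
    rw [preimage_sdiff, Set.mem_sdiff, Set.mem_sdiff, mem_preimage, mem_add_smul_iff,
      mem_add_smul_iff]
    refine and_congr_left fun _ => ⟨?_, ?_⟩
    · rintro ⟨w, hw, h⟩
      exact ⟨A.symm w, by simpa using hw, by simpa using h⟩
    · rintro ⟨w, hw, h⟩
      exact ⟨A w, hw, by simpa using h⟩
  have hint : ∀ t : ℝ, ∫ x in (B + t • W) \ B, φ x ∂Ω.measure = |frameVolume Ω A| *
      ∫ x in (A ⁻¹' B + t • (A ⁻¹' W)) \ (A ⁻¹' B), φ (A x) ∂(volume.prod volume) := by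
    intro t
    have hAe : MeasurableEmbedding (A : (Fin n → ℝ) × ℝ → V) :=
      A.toHomeomorph.measurableEmbedding
    rw [measure_eq_smul_map Ω A, Measure.restrict_smul, integral_smul_measure,
      ENNReal.toReal_ofReal (abs_nonneg _), smul_eq_mul, hAe.setIntegral_map, hpre t,
      Measure.volume_eq_prod]
  have hcomp : tsupport (φ ∘ A) ⊆ Y ×ˢ I := by
    have h1 : tsupport (φ ∘ A) ⊆ A ⁻¹' tsupport φ :=
      closure_minimal (fun x hx => subset_tsupport φ hx)
        ((isClosed_tsupport φ).preimage A.continuous)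
    intro x hx
    simpa using hφs (h1 hx)
  let S : V →L[ℝ] (Fin n → ℝ) × ℝ := (A.symm : V →L[ℝ] (Fin n → ℝ) × ℝ)
  have hRA : ∀ w ∈ A ⁻¹' W, ‖w‖ ≤ ‖S‖ * R := fun w hw => by
    have h1 : S (A w) = w := A.symm_apply_apply w
    have h2 := S.le_opNorm (A w)
    rw [h1] at h2
    exact h2.trans (mul_le_mul_of_nonneg_left (hR _ hw) (norm_nonneg _))
  have hlim := hG.tendsto_integral (volume : Measure (Fin n → ℝ)) (W := A ⁻¹' W)
    (R := ‖S‖ * R) (φ := φ ∘ A)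
    (h := fun y => dualFunctional Ω hΩ F (graphConormal A (fderiv ℝ g y) : V →ₗ[ℝ] ℝ))
    (hB.preimage A.continuous) (fun w hw => ?_) (hφ.comp A.continuous)
    (hφc.comp_homeomorph A.toHomeomorph) hcomp (fun y _ => hF.dualFunctional_nonneg _)
    (fun y _ => ?_)
  · have hval : ∫ y in Y, φ (graphMap A g y) * graphDensity Ω hΩ F A g y = |frameVolume Ω A| *
        ∫ y in Y, (φ ∘ A) (y, g y) *
          dualFunctional Ω hΩ F (graphConormal A (fderiv ℝ g y) : V →ₗ[ℝ] ℝ) := by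
      rw [← integral_const_mul]
      refine integral_congr_ae (Eventually.of_forall fun y => ?_)
      simp only [graphDensity, graphMap, Function.comp_apply]
      ring
    rw [hval]
    refine (hlim.const_mul |frameVolume Ω A|).congr fun t => ?_
    rw [hint]
    simp only [Function.comp_apply]
    ring
  · exact hRA w hw
  -- The height of `w` over the tangent plane is the conormal evaluated at `A w`, so its maximum
  -- over the Wulff shape is the value of `dualFunctional`.
  · refine IsGreatest.isLUB ⟨?_, ?_⟩
    · obtain ⟨v, hv, hveq⟩ := hF.exists_mem_wulffShape_eq (hΩ := hΩ)
        (graphConormal A (fderiv ℝ g y) : V →ₗ[ℝ] ℝ)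
      exact ⟨A.symm v, by simpa using hv, hveq⟩
    · rintro _ ⟨w, hw, rfl⟩
      have h3 := hF.mem_wulffShape_iff.mp hw (graphConormal A (fderiv ℝ g y) : V →ₗ[ℝ] ℝ)
      simpa [graphConormal_apply] using h3

end LocalLimit

/-! ### Gluing by a partition of unity. -/

section Global

variable {V : Type*} [NormedAddCommGroup V] [NormedSpace ℝ V] [FiniteDimensional ℝ V]

theorem eventually_diff_subset_cthickening {B W : Set V} {R : ℝ} (hR : ∀ w ∈ W, ‖w‖ ≤ R) {δ : ℝ}
    (hδ : 0 < δ) :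
    ∀ᶠ t in 𝓝[>] (0 : ℝ), (B + t • W) \ B ⊆ Metric.cthickening δ (frontier B) := by
  have hlim : Tendsto (fun t : ℝ => t * R) (𝓝[>] 0) (𝓝 0) := by
    have : Tendsto (fun t : ℝ => t * R) (𝓝 0) (𝓝 (0 * R)) := tendsto_id.mul_const R
    rw [zero_mul] at this
    exact this.mono_left nhdsWithin_le_nhds
  filter_upwards [hlim.eventually (gt_mem_nhds hδ), self_mem_nhdsWithin] with t ht ht0 x hx
  obtain ⟨w, hw, hb⟩ := mem_add_smul_iff.mp hx.1
  -- A point outside `B` has its distance to `B` realized at a frontier point, and that distance is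
  -- at most `t * ‖w‖` because `x - t • w` lies in `B`.
  obtain ⟨y, hy, hxy⟩ := exists_mem_frontier_infDist_compl_eq_dist (s := Bᶜ) hx.2
    (fun h => (h ▸ mem_univ (x - t • w) : x - t • w ∈ Bᶜ) hb)
  rw [frontier_compl] at hy
  rw [compl_compl] at hxy
  refine Metric.mem_cthickening_of_dist_le x y δ _ hy ?_
  calc dist x y = Metric.infDist x B := hxy.symm
    _ ≤ dist x (x - t • w) := Metric.infDist_le_dist_of_mem hb
    _ = t * ‖w‖ := by
        rw [dist_eq_norm, sub_sub_cancel, norm_smul, Real.norm_of_nonneg (le_of_lt ht0)]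
    _ ≤ t * R := mul_le_mul_of_nonneg_left (hR w hw) (le_of_lt ht0)
    _ ≤ δ := ht.le

theorem isCompact_frontier_of_isBounded {B : Set V} (hBb : Bornology.IsBounded B) :
    IsCompact (frontier B) :=
  Metric.isCompact_of_isClosed_isBounded isClosed_frontier
    (hBb.closure.subset frontier_subset_closure)

variable {n : ℕ} [Fact (Module.finrank ℝ V = n + 1)] {Ω : V [⋀^Fin (n + 1)]→ₗ[ℝ] ℝ} {hΩ : Ω ≠ 0}
  {F : ⋀[ℝ]^n V → ℝ} [MeasurableSpace V] [BorelSpace V] {B : Set V}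

theorem measureReal_add_smul_sub (hF : IsConvexDensity F) (hB : IsOpen B)
    (hBb : Bornology.IsBounded B) (t : ℝ) :
    Ω.measure.real (B + t • wulffShape Ω hΩ F) - Ω.measure.real B =
      Ω.measure.real ((B + t • wulffShape Ω hΩ F) \ B) := by
  obtain ⟨R, hR⟩ := hF.exists_norm_le_of_mem_wulffShape (hΩ := hΩ)
  have hWb : Bornology.IsBounded (wulffShape Ω hΩ F) := isBounded_iff_forall_norm_le.mpr ⟨R, hR⟩
  have hsub : B ⊆ B + t • wulffShape Ω hΩ F := fun b hb =>
    mem_add_smul_iff.mpr ⟨0, hF.zero_mem_wulffShape, by simpa using hb⟩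
  exact (measureReal_sdiff hsub hB.measurableSet
    (hBb.add (hWb.smul₀ t)).measure_lt_top.ne).symm

/-- The anisotropic area of a bounded open set with `C²` boundary is finite and equals its
anisotropic outer Minkowski content. -/
theorem HasC2Boundary.hasOuterMinkowskiContent (hΩ : Ω ≠ 0) (hF : IsConvexDensity F)
    (hB : IsOpen B) (hBb : Bornology.IsBounded B) (hBC2 : HasC2Boundary B) :
    anisotropicArea Ω F B ≠ ∞ ∧
      HasOuterMinkowskiContent Ω hΩ F B (anisotropicArea Ω F B).toReal := by
  have hV : Module.finrank ℝ V = n + 1 := Fact.out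
  have hK := isCompact_frontier_of_isBounded hBb
  choose A Y I g L hG hp using fun p : frontier B => hBC2.exists_isSubgraphOn hV hB p.2
  obtain ⟨T, hT⟩ := hK.elim_finite_subcover (fun p => (A p).symm ⁻¹' (Y p ×ˢ I p))
    (fun p => (hG p).isOpen_box) fun p hpB => mem_iUnion.mpr ⟨⟨p, hpB⟩, hp ⟨p, hpB⟩⟩
  set O : Fin T.card → Set V := fun i =>
    (A (T.equivFin.symm i)).symm ⁻¹' (Y (T.equivFin.symm i) ×ˢ I (T.equivFin.symm i)) with hO
  have hOo : ∀ i, IsOpen (O i) := fun i => (hG _).isOpen_box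
  have hcover : frontier B ⊆ ⋃ i, O i := by
    intro x hx
    obtain ⟨p, hpT, hxp⟩ := mem_iUnion₂.mp (hT hx)
    exact mem_iUnion.mpr ⟨T.equivFin ⟨p, hpT⟩, by simpa [hO] using hxp⟩
  have hfin : boundaryMeasure Ω F B (frontier B) < ∞ :=
    (measure_mono hcover).trans_lt ((measure_iUnion_le _).trans_lt (by
      rw [tsum_fintype]
      exact ENNReal.sum_lt_top.mpr fun i _ => (hG _).boundaryMeasure_box_lt_top hΩ hB hF))
  refine ⟨hfin.ne, ?_⟩
  obtain ⟨δ, hδ, hδO⟩ := hK.exists_cthickening_subset_open (isOpen_iUnion hOo) hcover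
  set K := Metric.cthickening δ (frontier B) with hKdef
  have hKc : IsCompact K := hK.cthickening
  -- The functions sum to `1` on a whole thickening of the frontier, so the sum of the localized
  -- integrals is the area on `frontier B` and also the full volume of the layer for small `t`.
  obtain ⟨f, hfO, hf1, -, hfc⟩ := exists_continuous_sum_one_of_isOpen_isCompact hOo hKc hδO
  have hsum : ∀ x ∈ K, ∑ i, f i x = 1 := fun x hx => by simpa using hf1 hx
  have : IsFiniteMeasure ((boundaryMeasure Ω F B).restrict (frontier B)) :=
    ⟨by rwa [Measure.restrict_apply_univ]⟩
  have hlim := tendsto_finsetSum Finset.univ fun i _ =>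
    (hG (T.equivFin.symm i)).tendsto_localized_content (hΩ := hΩ) hB hF (f i).continuous (hfc i)
      (hfO i)
  have harea : ∑ i, ∫ x in frontier B, f i x ∂boundaryMeasure Ω F B =
      (anisotropicArea Ω F B).toReal := by
    rw [← integral_finsetSum _ fun i _ => (f i).continuous.integrable_of_hasCompactSupport (hfc i),
      setIntegral_congr_fun isClosed_frontier.measurableSet
        (fun x hx => hsum x (Metric.self_subset_cthickening _ hx)), setIntegral_const, smul_eq_mul,
      mul_one]
    rfl
  rw [harea] at hlim
  obtain ⟨R, hR⟩ := hF.exists_norm_le_of_mem_wulffShape (hΩ := hΩ)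
  refine hlim.congr' ?_
  filter_upwards [eventually_diff_subset_cthickening (B := B) hR hδ] with t ht
  have hD : MeasurableSet ((B + t • wulffShape Ω hΩ F) \ B) :=
    hB.add_right.measurableSet.diff hB.measurableSet
  rw [← Finset.mul_sum, ← integral_finsetSum _ fun i _ =>
      ((f i).continuous.integrable_of_hasCompactSupport (hfc i)).integrableOn,
    setIntegral_congr_fun hD (fun x hx => hsum x (ht hx)), setIntegral_const, smul_eq_mul, mul_one,
    measureReal_add_smul_sub hF hB hBb, div_eq_inv_mul]

end Global

end AnisoMinkowski

theorem mainTheorem4 {V : Type*} [NormedAddCommGroup V] [NormedSpace ℝ V]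
    [FiniteDimensional ℝ V] [MeasurableSpace V] [BorelSpace V] {n : ℕ} [Fact (Module.finrank ℝ V = n + 1)]
    (Ω : V [⋀^Fin (n + 1)]→ₗ[ℝ] ℝ) (hΩ : Ω ≠ 0)
    (F : ⋀[ℝ]^n V → ℝ) (hF : AnisoMinkowski.IsConvexDensity F)
    (B : Set V) (hB : IsOpen B) (hBb : Bornology.IsBounded B)
    (hBC2 : AnisoMinkowski.HasC2Boundary B) :
    AnisoMinkowski.anisotropicArea Ω F B ≠ ∞ ∧
      AnisoMinkowski.HasOuterMinkowskiContent Ω hΩ F B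
        (AnisoMinkowski.anisotropicArea Ω F B).toReal := by
  exact hBC2.hasOuterMinkowskiContent hΩ hF hB hBb
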